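/- **Setting.** Let $(\Omega,\mathcal F,P)$ be a probability space, $\Xi\subseteq\mathbb R^d$, $\xi:\Omega\to\Xi$ a random variable, and let $f:\mathbb R\times\mathbb R^n\times\mathbb R^m\times\Xi\to\mathbb R^n$, $g:\mathbb R\times\mathbb R^n\times\mathbb R^m\times\Xi\to\mathbb R$, $A:\Xi\to\mathbb R^{q\times n}$, $B:\Xi\to\mathbb R^{q\times m}$, $Q:\mathbb R\times\Xi\to\mathbb R^q$, $x_0\in\mathbb R^n$. "A.e. $s$" refers to the distribution of $\xi$, and $\|\cdot\|$ is the Euclidean norm. Assume that $f(t,x,y,\xi)$, $g(t,x,y,\xi)$, $A(\xi)$, $B(\xi)$, $Q(t,\xi)$ are integrable for all $t\ge0$, $x$, $y$, and that: * there is a measurable $\kappa_f\ge 0$ with $\mathbb E[\kappa_f(\xi)]<\infty$ such that for a.e. $s$, $\|f(t_1,u_1,v_1,s)-f(t_2,u_2,v_2,s)\|\le\kappa_f(s)(|t_1-t_2|+\|u_1-u_2\|+\|v_1-v_2\|)$ for all $t_1,t_2\ge0$ and all $u_1,u_2,v_1,v_2$; * $g(t,x,\cdot,s)$ is convex for all $t\ge0$,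 $x$ and a.e. $s$; for a.e. $s$, $g(\cdot,\cdot,\cdot,s)$ is continuous on $[0,\infty)\times\mathbb R^n\times\mathbb R^m$; and on every bounded set of $(t,x,y)$, $t\ge0$, $|g(t,x,y,\xi)|$ is dominated by an integrable function of $\xi$; * for a.e. $s$, $Q(\cdot,s)$ is continuous on $[0,\infty)$, and there is a measurable $\kappa_Q\ge0$ with $\mathbb E[\kappa_Q(\xi)]<\infty$ and $\|Q(t,s)\|\le\kappa_Q(s)\,t$ for all $t\ge0$ and a.e. $s$; * (strong convexity) there is a measurable $\varrho:\Xi\to(0,\infty)$ with $\mathbb E[\varrho(\xi)]<\infty$ such that for all $t\ge0$, $x$ and a.e. $s$, for all $y_1,y_2$ and $\tau\in(0,1)$, $$g(t,x,(1-\tau)y_1+\tau y_2,s)\le(1-\tau)g(t,x,y_1,s)+\tau g(t,x,y_2,s)-\tfrac12\varrho(s)\tau(1-\tau)\|y_1-y_2\|^2.$$ Put $K(t,x)=\{y:\mathbb E[A(\xi)]x+\mathbb E[B(\xi)]y+\mathbb E[Q(t,\xi)]\le0\}$ (componentwise) and let $\mathcal S(t,x)$ be the set of minimizers of $\mathbb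 E[g(t,x,\cdot,\xi)]$ over $K(t,x)$. Assume $\operatorname{int}K(0,x_0)\ne\emptyset$ and that no constraint of $K(0,x_0)$ reads $0\le0$: there is no $i$ with $(\mathbb E[B(\xi)])_{i\cdot}=0$ and $(\mathbb E[A(\xi)]x_0+\mathbb E[Q(0,\xi)])_i=0$. (Together these two conditions say that all constraints hold strictly at some $y$.) A weak solution over $[0,T]$ is a pair $(x,y)$ with $x$ absolutely continuous and $y$ integrable on $[0,T]$, such that for all $t\in[0,T]$, $y(t)\in\mathcal S(t,x(t))$ and $x(t)=x_0+\int_0^t\mathbb E[f(\tau,x(\tau),y(\tau),\xi)]\,d\tau$. Let $\xi_1,\xi_2,\dots$ be i.i.d. copies of $\xi$ on $\Omega$. For $T>0$, a sample size $\nu$ and a step size $h=T/N$, with $t_i=ih$, a solution of the scheme consists of $\mathbf x^\nu_0=x_0$ and $\mathbf x^\nu_{i+1},\mathbf y^\nu_{i+1}$, $0\le i<N$, such that $$\mathbf x^\nu_{i+1}=\mathbf x^\nu_i+\frac h\nu\sum_{\ell=1}^\nu f(t_{i+1},\mathbf x^\nu_{i+1},\mathbf y^\nu_{i+1},\xi_\ell)$$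 and $\mathbf y^\nu_{i+1}$ minimizes $\frac1\nu\sum_{\ell=1}^\nu g(t_{i+1},\mathbf x^\nu_i,\cdot,\xi_\ell)$ over $\{y:\frac1\nu\sum_{\ell=1}^\nu(A(\xi_\ell)\mathbf x^\nu_i+B(\xi_\ell)y+Q(t_{i+1},\xi_\ell))\le0\}$. Its interpolants on $[0,T]$ are $x^\nu_h(t)=\mathbf x^\nu_i+\frac{t-t_i}{h}(\mathbf x^\nu_{i+1}-\mathbf x^\nu_i)$ and $y^\nu_h(t)=\mathbf y^\nu_{i+1}$ for $t\in(t_i,t_{i+1}]$, with $x^\nu_h(0)=x_0$. **Theorem.** There is a deterministic $T_0>0$ such that for every $\bar T\in(0,T_0]$ the following holds with probability 1. For all sufficiently large $\nu$ and then all sufficiently large $N$ the scheme on $[0,\bar T]$ has a solution; and for any choice of such solutions, with interpolants $(x^\nu_h,y^\nu_h)$, there are sequences $\nu_k\uparrow\infty$ and $h_j=\bar T/N_j\downarrow0$ and a weak solution $(x^*,y^*)$ over $[0,\bar T]$ such that $$\lim_{k\to\infty}\lim_{j\to\infty}\sup_{t\in[0,\bar T]}\|x^{\nu_k}_{h_j}(t)-x^*(t)\|=0,\qquad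 \lim_{k\to\infty}\lim_{j\to\infty}\Big(\int_0^{\bar T}\|y^{\nu_k}_{h_j}(t)-y^*(t)\|^2dt\Big)^{1/2}=0,$$ where all inner limits exist. The sequences and $(x^*,y^*)$ may depend on the realization of the sample. -/

import Mathlib

open MeasureTheory ProbabilityTheory Filter Topology Set
open scoped ENNReal NNReal Matrix

noncomputable section

/-- Data of an ordinary differential equation coupled with a parametric stochastic program:
state in `ℝⁿ`, decision in `ℝᵐ`, `q` linear constraints, random parameter with values in `Ξ`. -/
structure CoupledSystem (n m q : ℕ) (Ξ : Type*) where
  /-- integrand of the right-hand side of the differential equation -/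
  f : ℝ → EuclideanSpace ℝ (Fin n) → EuclideanSpace ℝ (Fin m) → Ξ → EuclideanSpace ℝ (Fin n)
  /-- integrand of the objective function -/
  g : ℝ → EuclideanSpace ℝ (Fin n) → EuclideanSpace ℝ (Fin m) → Ξ → ℝ
  /-- constraint matrix acting on the state -/
  A : Ξ → Matrix (Fin q) (Fin n) ℝ
  /-- constraint matrix acting on the decision -/
  B : Ξ → Matrix (Fin q) (Fin m) ℝ
  /-- time-dependent constraint vector -/
  Q : ℝ → Ξ → EuclideanSpace ℝ (Fin q)
  /-- initial state -/
  x₀ : EuclideanSpace ℝ (Fin n)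

namespace CoupledSystem

variable {n m q : ℕ} {Ξ : Type*} [MeasurableSpace Ξ]
  {Ω : Type*} [MeasurableSpace Ω]

/-! ### The problem with exact expectations -/

/-- `E[f(t, x, y, ξ)]`. -/
def meanF (p : CoupledSystem n m q Ξ) (P : Measure Ω) (ξ : Ω → Ξ) (t : ℝ)
    (x : EuclideanSpace ℝ (Fin n)) (y : EuclideanSpace ℝ (Fin m)) : EuclideanSpace ℝ (Fin n) :=
  ∫ ω, p.f t x y (ξ ω) ∂P

/-- `E[g(t, x, y, ξ)]`. -/
def meanG (p : CoupledSystem n m q Ξ) (P : Measure Ω) (ξ : Ω → Ξ) (t : ℝ)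
    (x : EuclideanSpace ℝ (Fin n)) (y : EuclideanSpace ℝ (Fin m)) : ℝ :=
  ∫ ω, p.g t x y (ξ ω) ∂P

/-- `E[A(ξ)]`, entrywise. -/
def meanA (p : CoupledSystem n m q Ξ) (P : Measure Ω) (ξ : Ω → Ξ) : Matrix (Fin q) (Fin n) ℝ :=
  Matrix.of fun i j => ∫ ω, p.A (ξ ω) i j ∂P

/-- `E[B(ξ)]`, entrywise. -/
def meanB (p : CoupledSystem n m q Ξ) (P : Measure Ω) (ξ : Ω → Ξ) : Matrix (Fin q) (Fin m) ℝ :=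
  Matrix.of fun i j => ∫ ω, p.B (ξ ω) i j ∂P

/-- `E[Q(t, ξ)]`. -/
def meanQ (p : CoupledSystem n m q Ξ) (P : Measure Ω) (ξ : Ω → Ξ) (t : ℝ) :
    EuclideanSpace ℝ (Fin q) :=
  ∫ ω, p.Q t (ξ ω) ∂P

/-- The feasible set `K(t, x) = {y | E[A(ξ)] x + E[B(ξ)] y + E[Q(t, ξ)] ≤ 0}`. -/
def feasible (p : CoupledSystem n m q Ξ) (P : Measure Ω) (ξ : Ω → Ξ) (t : ℝ)
    (x : EuclideanSpace ℝ (Fin n)) : Set (EuclideanSpace ℝ (Fin m)) :=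
  {y | ∀ i, (p.meanA P ξ *ᵥ x.ofLp) i + (p.meanB P ξ *ᵥ y.ofLp) i + p.meanQ P ξ t i ≤ 0}

/-- The set of minimizers of `E[g(t, x, ·, ξ)]` over `K(t, x)`. -/
def solutionSet (p : CoupledSystem n m q Ξ) (P : Measure Ω) (ξ : Ω → Ξ) (t : ℝ)
    (x : EuclideanSpace ℝ (Fin n)) : Set (EuclideanSpace ℝ (Fin m)) :=
  {y | y ∈ p.feasible P ξ t x ∧ ∀ z ∈ p.feasible P ξ t x, p.meanG P ξ t x y ≤ p.meanG P ξ t x z}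

/-- `(x, y)` is a weak solution of the coupled system over `[0, T]`. -/
structure IsWeakSolution (p : CoupledSystem n m q Ξ) (P : Measure Ω) (ξ : Ω → Ξ) (T : ℝ)
    (x : ℝ → EuclideanSpace ℝ (Fin n)) (y : ℝ → EuclideanSpace ℝ (Fin m)) : Prop where
  absolutelyContinuous : AbsolutelyContinuousOnInterval x 0 T
  integrable : IntegrableOn y (Icc 0 T) volume
  mem_solutionSet : ∀ t ∈ Icc 0 T, y t ∈ p.solutionSet P ξ t (x t)
  integral_eq : ∀ t ∈ Icc 0 T, x t = p.x₀ + ∫ τ in 0..t, p.meanF P ξ τ (x τ) (y τ)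

/-! ### Assumptions -/

/-- The standing assumptions on the data. "Almost every `s ∈ Ξ`" refers to the distribution
`P.map ξ` of `ξ`. -/
structure StandingAssumptions (p : CoupledSystem n m q Ξ) (P : Measure Ω) (ξ : Ω → Ξ) : Prop where
  integrable_f : ∀ t, 0 ≤ t → ∀ x y, Integrable (p.f t x y) (P.map ξ)
  integrable_g : ∀ t, 0 ≤ t → ∀ x y, Integrable (p.g t x y) (P.map ξ)
  integrable_A : ∀ i j, Integrable (fun s => p.A s i j) (P.map ξ)
  integrable_B : ∀ i j, Integrable (fun s => p.B s i j) (P.map ξ)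
  integrable_Q : ∀ t, 0 ≤ t → Integrable (p.Q t) (P.map ξ)
  /-- `f` is Lipschitz in `(t, x, y)` with an integrable random constant. -/
  lipschitz_f : ∃ κ : Ξ → ℝ, Measurable κ ∧ (∀ s, 0 ≤ κ s) ∧ Integrable κ (P.map ξ) ∧
    ∀ᵐ s ∂(P.map ξ), ∀ t₁ t₂ : ℝ, 0 ≤ t₁ → 0 ≤ t₂ → ∀ u₁ u₂ v₁ v₂,
      ‖p.f t₁ u₁ v₁ s - p.f t₂ u₂ v₂ s‖ ≤ κ s * (|t₁ - t₂| + ‖u₁ - u₂‖ + ‖v₁ - v₂‖)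
  convex_g : ∀ t, 0 ≤ t → ∀ x, ∀ᵐ s ∂(P.map ξ), ConvexOn ℝ univ fun y => p.g t x y s
  continuous_g : ∀ᵐ s ∂(P.map ξ), ContinuousOn
    (fun z : ℝ × EuclideanSpace ℝ (Fin n) × EuclideanSpace ℝ (Fin m) => p.g z.1 z.2.1 z.2.2 s)
    (Ici 0 ×ˢ univ)
  /-- On every bounded set of `(t, x, y)`, `g` is dominated by an integrable function of `ξ`. -/
  dominated_g : ∀ R : ℝ, ∃ κ : Ξ → ℝ, Integrable κ (P.map ξ) ∧
    ∀ᵐ s ∂(P.map ξ), ∀ t x y, 0 ≤ t → t ≤ R → ‖x‖ ≤ R → ‖y‖ ≤ R → |p.g t x y s| ≤ κ s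
  continuous_Q : ∀ᵐ s ∂(P.map ξ), ContinuousOn (fun t => p.Q t s) (Ici 0)
  bound_Q : ∃ κ : Ξ → ℝ, Measurable κ ∧ (∀ s, 0 ≤ κ s) ∧ Integrable κ (P.map ξ) ∧
    ∀ᵐ s ∂(P.map ξ), ∀ t, 0 ≤ t → ‖p.Q t s‖ ≤ κ s * t

/-- Strong convexity of `g(t, x, ·, s)` with a positive integrable random modulus. -/
def StronglyConvex (p : CoupledSystem n m q Ξ) (P : Measure Ω) (ξ : Ω → Ξ) : Prop :=
  ∃ ϱ : Ξ → ℝ, Measurable ϱ ∧ (∀ s, 0 < ϱ s) ∧ Integrable ϱ (P.map ξ) ∧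
    ∀ t, 0 ≤ t → ∀ x, ∀ᵐ s ∂(P.map ξ), ∀ y₁ y₂, ∀ τ ∈ Ioo (0 : ℝ) 1,
      p.g t x ((1 - τ) • y₁ + τ • y₂) s ≤
        (1 - τ) * p.g t x y₁ s + τ * p.g t x y₂ s - 1 / 2 * ϱ s * τ * (1 - τ) * ‖y₁ - y₂‖ ^ 2

/-- No constraint of `K(0, x₀)` reads `0 ≤ 0`: a constraint row on which `E[B(ξ)]` vanishes
is not active. -/
def NoVacuousActiveRow (p : CoupledSystem n m q Ξ) (P : Measure Ω) (ξ : Ω → Ξ) : Prop :=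
  ∀ i, ¬ ((∀ j, p.meanB P ξ i j = 0) ∧
    (p.meanA P ξ *ᵥ p.x₀.ofLp) i + p.meanQ P ξ 0 i = 0)

/-! ### Sample averages and the time-stepping scheme

`s : ℕ → Ξ` is a realization of the sample; the average over a sample of size `ν` uses the first
`ν` entries. -/

/-- `(1/ν) ∑ f(t, x, y, ξ_ℓ)`. -/
def sampleF (p : CoupledSystem n m q Ξ) (s : ℕ → Ξ) (ν : ℕ) (t : ℝ)
    (x : EuclideanSpace ℝ (Fin n)) (y : EuclideanSpace ℝ (Fin m)) : EuclideanSpace ℝ (Fin n) :=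
  (1 / (ν : ℝ)) • ∑ l ∈ Finset.range ν, p.f t x y (s l)

/-- `(1/ν) ∑ g(t, x, y, ξ_ℓ)`. -/
def sampleG (p : CoupledSystem n m q Ξ) (s : ℕ → Ξ) (ν : ℕ) (t : ℝ)
    (x : EuclideanSpace ℝ (Fin n)) (y : EuclideanSpace ℝ (Fin m)) : ℝ :=
  (1 / (ν : ℝ)) * ∑ l ∈ Finset.range ν, p.g t x y (s l)

/-- `K^ν(t, x) = {y | (1/ν) ∑ (A(ξ_ℓ) x + B(ξ_ℓ) y + Q(t, ξ_ℓ)) ≤ 0}`. -/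
def sampleFeasible (p : CoupledSystem n m q Ξ) (s : ℕ → Ξ) (ν : ℕ) (t : ℝ)
    (x : EuclideanSpace ℝ (Fin n)) : Set (EuclideanSpace ℝ (Fin m)) :=
  {y | ∀ i, (1 / (ν : ℝ)) * ∑ l ∈ Finset.range ν,
    ((p.A (s l) *ᵥ x.ofLp) i + (p.B (s l) *ᵥ y.ofLp) i + p.Q t (s l) i) ≤ 0}

/-- The set of minimizers of the sample average objective over `K^ν(t, x)`. -/
def sampleSolutionSet (p : CoupledSystem n m q Ξ) (s : ℕ → Ξ) (ν : ℕ) (t : ℝ)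
    (x : EuclideanSpace ℝ (Fin n)) : Set (EuclideanSpace ℝ (Fin m)) :=
  {y | y ∈ p.sampleFeasible s ν t x ∧
    ∀ z ∈ p.sampleFeasible s ν t x, p.sampleG s ν t x y ≤ p.sampleG s ν t x z}

/-- `X 0, …, X N` and `Y 1, …, Y N` solve the implicit Euler scheme with sample size `ν` and
step size `h = T / N` on `[0, T]` (other values of `X` and `Y` are irrelevant). -/
structure IsSchemeSolution (p : CoupledSystem n m q Ξ) (s : ℕ → Ξ) (T : ℝ) (ν N : ℕ)
    (X : ℕ → EuclideanSpace ℝ (Fin n)) (Y : ℕ → EuclideanSpace ℝ (Fin m)) : Prop where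
  init : X 0 = p.x₀
  state_step : ∀ i < N, X (i + 1) = X i +
    (T / N) • p.sampleF s ν ((i + 1 : ℕ) * (T / N)) (X (i + 1)) (Y (i + 1))
  argmin_step : ∀ i < N, Y (i + 1) ∈ p.sampleSolutionSet s ν ((i + 1 : ℕ) * (T / N)) (X i)

end CoupledSystem

/-- The index `i` with `t ∈ (i h, (i + 1) h]`, for `t > 0`; it is `0` at `t = 0`. -/
def stepIndex (h t : ℝ) : ℕ := ⌈t / h⌉₊ - 1

/-- Piecewise linear interpolant: `X i + ((t - t_i) / h) (X (i + 1) - X i)` on `(t_i, t_{i+1}]`,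
and `X 0` at `t = 0`, where `t_i = i h`. -/
def linearInterpolant {E : Type*} [AddCommGroup E] [Module ℝ E] (h : ℝ) (X : ℕ → E) (t : ℝ) : E :=
  X (stepIndex h t) +
    ((t - stepIndex h t * h) / h) • (X (stepIndex h t + 1) - X (stepIndex h t))

/-- Piecewise constant interpolant: `Y (i + 1)` on `(t_i, t_{i+1}]`, where `t_i = i h`. -/
def constantInterpolant {E : Type*} (h : ℝ) (Y : ℕ → E) (t : ℝ) : E :=
  Y (stepIndex h t + 1)

/-- `sup_{t ∈ [0, T]} ‖u t - v t‖`, as an extended nonnegative real. -/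
def supDist {E : Type*} [NormedAddCommGroup E] (T : ℝ) (u v : ℝ → E) : ℝ≥0∞ :=
  ⨆ t ∈ Icc (0 : ℝ) T, ‖u t - v t‖ₑ

/-- `(∫₀ᵀ ‖u t - v t‖² dt)^{1/2}`, as an extended nonnegative real. -/
def l2Dist {E : Type*} [NormedAddCommGroup E] (T : ℝ) (u v : ℝ → E) : ℝ≥0∞ :=
  eLpNorm (fun t => u t - v t) 2 (volume.restrict (Icc (0 : ℝ) T))

/-- The iterated limit `lim_{k → ∞} lim_{j → ∞} a k j` equals `0`: every inner limit exists (and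
is finite), and the inner limits tend to `0`. -/
def IteratedLimitZero (a : ℕ → ℕ → ℝ≥0∞) : Prop :=
  ∃ L : ℕ → ℝ≥0, (∀ k, Tendsto (a k) atTop (𝓝 (L k : ℝ≥0∞))) ∧ Tendsto L atTop (𝓝 0)

end

/-!
The proof separates probability from analysis.

**Probability.** The strong law of large numbers in the Banach space of continuous functions on a
ball gives a locally uniform law of large numbers (`ae_continuouslyConverges_sample_average`).
Hence, along almost every sample, the right-hand sides, objectives and constraints of the sample
average problems converge locally uniformly to those of the problem with exact expectations
(`CoupledSystem.ae_converges_sampleProgram`), while their Lipschitz constants and strong convexity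
moduli are eventually bounded by deterministic constants. The rest of the argument concerns one
such sample.

**Parametric programs.** The interior point is a Slater point at `(0, x₀)`, hence also for nearby
times and states and for all large samples. Strong convexity then gives a unique minimizer, bounded
uniformly in time, state and sample size, and a compactness argument shows that it depends
continuously on time, state and the problem itself
(`CoupledProgram.Converges.tendsto_solutions`). This single stability result serves both limits.

**Limits.** All relevant bounds are collected in `ControlConstants`, chosen from the limit problem
with a margin; they determine `T₀`. On `[0, T]` with `T ≤ T₀` the scheme stays in the controlled
region and its implicit steps are contractions, so it is solvable, and all its interpolated states
share a Lipschitz constant. By the Arzelà–Ascoli theorem and Tychonoff's theorem, one sequence of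
step numbers makes the states converge for all sample sizes simultaneously; the limits solve the
sample average system, because the state interpolant is the integral of the piecewise constant
right-hand sides, which converge pointwise and boundedly. A second extraction, over sample sizes,
yields a trajectory of the limit system by the same reasoning. The decisions converge pointwise by
stability, hence in `L²` by dominated convergence
(`CoupledProgram.Converges.exists_iterated_limits`).
-/

/-! ### Uniform laws of large numbers -/

section UniformLaw

/-- A random continuous function on a compact metric space is measurable as soon as its values at
all points are: evaluation on a countable dense set is a continuous injection of a Polish space,
hence a measurable embedding. -/
theorem aemeasurable_continuousMap_of_eval {K S W : Type*} [MetricSpace K] [CompactSpace K]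
    [NormedAddCommGroup W] [CompleteSpace W] [SecondCountableTopology W]
    [MeasurableSpace C(K, W)] [BorelSpace C(K, W)] [MeasurableSpace S] {μ : Measure S}
    {H : S → C(K, W)} (hH : ∀ k, AEStronglyMeasurable (fun s => H s k) μ) : AEMeasurable H μ := by
  borelize W
  obtain ⟨D, hDc, hD⟩ := TopologicalSpace.exists_countable_dense K
  have : Countable D := hDc.to_subtype
  let Φ : C(K, W) → (D → W) := fun c k => c k
  have hΦ : Continuous Φ := continuous_pi fun k => continuous_eval_const (k : K)
  have hinj : Function.Injective Φ := by
    intro a b hab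
    have : (a : K → W) = b := a.continuous.ext_on hD b.continuous fun k hk => congrFun hab ⟨k, hk⟩
    exact DFunLike.coe_injective this
  rw [← (hΦ.measurableEmbedding hinj).aemeasurable_comp_iff, aemeasurable_pi_iff]
  exact fun k => (hH k).aemeasurable

variable {Ω S W : Type*} [MeasurableSpace Ω] [MeasurableSpace S] {P : Measure Ω}
  {ξ : Ω → S} {sample : ℕ → Ω → S}
  [NormedAddCommGroup W] [NormedSpace ℝ W] [CompleteSpace W] [SecondCountableTopology W]

/-- Almost sure properties of the common distribution hold along almost every sample. -/
theorem ae_forall_sample (hident : ∀ l, IdentDistrib (sample l) ξ P P) {p : S → Prop}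
    (hp : ∀ᵐ s ∂(P.map ξ), p s) : ∀ᵐ ω ∂P, ∀ l, p (sample l ω) := by
  refine ae_all_iff.2 fun l => ?_
  rw [← (hident l).map_eq] at hp
  exact ae_of_ae_map (hident l).aemeasurable_fst hp

/-- The strong law of large numbers for a function of an i.i.d. sample. -/
theorem ae_tendsto_sample_average {W : Type*} [NormedAddCommGroup W] [NormedSpace ℝ W]
    [CompleteSpace W] [MeasurableSpace W] [BorelSpace W]
    (hξ : AEMeasurable ξ P) (hindep : iIndepFun sample P)
    (hident : ∀ l, IdentDistrib (sample l) ξ P P) {h : S → W} (hh : Integrable h (P.map ξ)) :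
    ∀ᵐ ω ∂P, Tendsto (fun ν : ℕ => (1 / (ν : ℝ)) • ∑ l ∈ Finset.range ν, h (sample l ω)) atTop
      (𝓝 (∫ ω, h (ξ ω) ∂P)) := by
  have hmap : ∀ l, P.map (sample l) = P.map ξ := fun l => (hident l).map_eq
  have haem : ∀ l, AEMeasurable h (P.map (sample l)) := fun l => by
    rw [hmap]; exact hh.1.aemeasurable
  have hid : ∀ l, IdentDistrib (h ∘ sample l) (h ∘ ξ) P P := fun l =>
    (hident l).comp_of_aemeasurable (haem l)
  have hint : Integrable (h ∘ ξ) P := hh.comp_aemeasurable hξ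
  have := strong_law_ae (μ := P) (fun l => h ∘ sample l) ((hid 0).integrable_iff.2 hint)
    (fun i j hij => (hindep.indepFun hij).comp₀ (hident i).aemeasurable_fst
      (hident j).aemeasurable_fst (haem i) (haem j))
    (fun i => (hid i).trans (hid 0).symm)
  rw [(hid 0).integral_eq] at this
  simpa using this

/-- Uniform law of large numbers over a compact parameter set: the strong law in the Banach space
of continuous functions. -/
theorem ae_tendstoUniformly_sample_average {K : Type*} [MetricSpace K] [CompactSpace K]
    (hξ : AEMeasurable ξ P) (hindep : iIndepFun sample P)
    (hident : ∀ l, IdentDistrib (sample l) ξ P P) {h : K → S → W}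
    (hmeas : ∀ k, AEStronglyMeasurable (h k) (P.map ξ))
    (hcont : ∀ᵐ s ∂(P.map ξ), Continuous fun k => h k s)
    {κ : S → ℝ} (hκ : Integrable κ (P.map ξ)) (hbound : ∀ᵐ s ∂(P.map ξ), ∀ k, ‖h k s‖ ≤ κ s) :
    ∀ᵐ ω ∂P, TendstoUniformly
      (fun (ν : ℕ) k => (1 / (ν : ℝ)) • ∑ l ∈ Finset.range ν, h k (sample l ω))
      (fun k => ∫ ω, h k (ξ ω) ∂P) atTop := by
  classical
  borelize C(K, W)
  let H : S → C(K, W) := fun s => if hs : Continuous fun k => h k s then ⟨_, hs⟩ else 0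
  have hHeq : ∀ s, (Continuous fun k => h k s) → ∀ k, H s k = h k s := fun s hs k => by
    simp [H, hs]
  have hHk : ∀ k, (fun s => H s k) =ᵐ[P.map ξ] h k := fun k => by
    filter_upwards [hcont] with s hs using hHeq s hs k
  have hHm : AEMeasurable H (P.map ξ) :=
    aemeasurable_continuousMap_of_eval fun k => (hmeas k).congr (hHk k).symm
  have hHint : Integrable H (P.map ξ) := by
    refine hκ.mono hHm.aestronglyMeasurable ?_
    filter_upwards [hcont, hbound] with s hs hb
    exact (ContinuousMap.norm_le _ (norm_nonneg _)).2 fun k =>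
      (hHeq s hs k).symm ▸ (hb k).trans (le_abs_self _)
  filter_upwards [ae_tendsto_sample_average hξ hindep hident hHint,
    ae_forall_sample hident hcont] with ω hω hc
  rw [ContinuousMap.tendsto_iff_tendstoUniformly] at hω
  have hl : ∀ k, (∫ ω, H (ξ ω) ∂P) k = ∫ ω, h k (ξ ω) ∂P := fun k => by
    have h1 := (ContinuousMap.evalCLM (α := K) (M := W) ℝ k).integral_comp_comm
      (hHint.comp_aemeasurable hξ)
    simp only [ContinuousMap.evalCLM_apply, Function.comp] at h1
    rw [← h1]
    exact integral_congr_ae (ae_of_ae_map hξ (hHk k))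
  have he : (fun (ν : ℕ) (k : K) => (1 / (ν : ℝ)) • ∑ l ∈ Finset.range ν, h k (sample l ω)) =
      fun (ν : ℕ) (k : K) =>
        ((1 / (ν : ℝ)) • ∑ l ∈ Finset.range ν, H (sample l ω) : C(K, W)) k := by
    funext ν k
    simp only [ContinuousMap.coe_smul, Pi.smul_apply, ContinuousMap.sum_apply]
    congr 1
    exact Finset.sum_congr rfl fun l _ => (hHeq _ (hc l) k).symm
  rw [he, ← funext hl]
  exact hω

/-- `φ i` converges continuously to `ψ` along `l`: `φ i z' → ψ z` as `i` runs along `l` and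
`z' → z`. On a locally compact space with continuous `ψ` this is locally uniform convergence. -/
def ContinuouslyConverges {I Z W : Type*} [TopologicalSpace Z] [TopologicalSpace W] (l : Filter I)
    (φ : I → Z → W) (ψ : Z → W) : Prop :=
  ∀ z, Tendsto (fun p : I × Z => φ p.1 p.2) (l ×ˢ 𝓝 z) (𝓝 (ψ z))

theorem ContinuouslyConverges.comp {I J Z W : Type*} [TopologicalSpace Z] [TopologicalSpace W]
    {l : Filter I} {φ : I → Z → W} {ψ : Z → W} (h : ContinuouslyConverges l φ ψ)
    {m : Filter J} {i : J → I} {ζ : J → Z} {z : Z} (hi : Tendsto i m l)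
    (hζ : Tendsto ζ m (𝓝 z)) : Tendsto (fun j => φ (i j) (ζ j)) m (𝓝 (ψ z)) :=
  (h z).comp (hi.prodMk hζ)

/-- A random field on a proper metric space whose paths are continuous and dominated on bounded
sets obeys the law of large numbers locally uniformly, and its mean is continuous. -/
theorem ae_continuouslyConverges_sample_average [IsProbabilityMeasure P] {Z : Type*}
    [MetricSpace Z] [ProperSpace Z] (z₀ : Z)
    (hξ : AEMeasurable ξ P) (hindep : iIndepFun sample P)
    (hident : ∀ l, IdentDistrib (sample l) ξ P P) {h : Z → S → W}
    (hmeas : ∀ z, AEStronglyMeasurable (h z) (P.map ξ))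
    (hcont : ∀ᵐ s ∂(P.map ξ), Continuous fun z => h z s)
    (hbound : ∀ R : ℝ, ∃ κ : S → ℝ, Integrable κ (P.map ξ) ∧
      ∀ᵐ s ∂(P.map ξ), ∀ z ∈ Metric.closedBall z₀ R, ‖h z s‖ ≤ κ s) :
    ∀ᵐ ω ∂P, ContinuouslyConverges atTop
      (fun (ν : ℕ) z => (1 / (ν : ℝ)) • ∑ l ∈ Finset.range ν, h z (sample l ω))
      (fun z => ∫ ω, h z (ξ ω) ∂P) := by
  have key : ∀ R : ℕ, ∀ᵐ ω ∂P, TendstoUniformlyOn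
      (fun (ν : ℕ) z => (1 / (ν : ℝ)) • ∑ l ∈ Finset.range ν, h z (sample l ω))
      (fun z => ∫ ω, h z (ξ ω) ∂P) atTop (Metric.closedBall z₀ R) := by
    intro R
    have : CompactSpace (Metric.closedBall z₀ (R : ℝ)) :=
      isCompact_iff_compactSpace.1 (isCompact_closedBall _ _)
    obtain ⟨κ, hκ, hb⟩ := hbound R
    filter_upwards [ae_tendstoUniformly_sample_average (K := Metric.closedBall z₀ (R : ℝ))
      (h := fun z s => h z s) hξ hindep hident (fun k => hmeas k)
      (by filter_upwards [hcont] with s hs using hs.comp continuous_subtype_val) hκ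
      (by filter_upwards [hb] with s hs using fun k => hs k k.2)] with ω hω
    rw [tendstoUniformlyOn_iff_tendstoUniformly_comp_coe]
    exact hω
  filter_upwards [ae_all_iff.2 key, ae_forall_sample hident hcont] with ω hω hc z
  obtain ⟨R, hR⟩ := exists_nat_gt (dist z z₀)
  have hmem : Metric.closedBall z₀ (R : ℝ) ∈ 𝓝 z := Metric.closedBall_mem_nhds_of_mem hR
  have hcont' : ContinuousOn (fun z => ∫ ω, h z (ξ ω) ∂P) (Metric.closedBall z₀ R) := by
    refine (hω R).continuousOn (Eventually.frequently (Eventually.of_forall fun ν => ?_))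
    exact (continuous_const.smul (continuous_finsetSum _ fun l _ => hc l)).continuousOn
  have h1 : TendstoUniformlyOnFilter
      (fun (ν : ℕ) z => (1 / (ν : ℝ)) • ∑ l ∈ Finset.range ν, h z (sample l ω))
      (fun z => ∫ ω, h z (ξ ω) ∂P) atTop (𝓝 z) :=
    (tendstoUniformlyOn_iff_tendstoUniformlyOnFilter.1 (hω R)).mono_right
      (le_principal_iff.2 hmem)
  rw [Metric.tendsto_nhds]
  intro ε hε
  have h2 := Metric.tendstoUniformlyOnFilter_iff.1 h1 (ε / 2) (half_pos hε)
  have h3 := (Metric.tendsto_nhds.1 (hcont'.continuousAt hmem) (ε / 2) (half_pos hε)).prod_inr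
    (atTop : Filter ℕ)
  filter_upwards [h2, h3] with p hp1 hp2
  rw [dist_comm] at hp1
  exact (dist_triangle _ _ _).trans_lt (by simpa using add_lt_add hp1 hp2)

end UniformLaw

/-! ### Parametric strongly convex programs and their stability -/

/-- A deterministic coupled problem on `ℝ × E × V` (time, state, decision): right-hand side `F`,
objective `G` and constraints `c i ≤ 0`. Both the exact and the sample average problem are of this
kind. -/
structure CoupledProgram (E V ι : Type*) where
  /-- right-hand side of the differential equation -/
  F : ℝ × E × V → E
  /-- objective -/
  G : ℝ × E × V → ℝ
  /-- constraint functions -/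
  c : ι → ℝ × E × V → ℝ

/-- Constants that control a family of coupled problems uniformly: an initial state `x₀`, a Slater
point `y₀`, the extents `τ` and `r` of the region `[0, τ] × closedBall x₀ r` of times and states, a
Lipschitz constant `L`, a strong convexity modulus `ϱ`, a bound `C` for the objective near `y₀` and
a bound `M` for the right-hand side at one point. -/
structure ControlConstants (E V : Type*) where
  /-- initial state -/
  x₀ : E
  /-- Slater point -/
  y₀ : V
  /-- length of the time interval -/
  τ : ℝ
  /-- radius of the ball of states -/
  r : ℝ
  /-- Lipschitz constant of the right-hand side -/
  L : ℝ
  /-- strong convexity modulus of the objective -/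
  ϱ : ℝ
  /-- bound of the objective on the unit ball around the Slater point -/
  C : ℝ
  /-- bound of the right-hand side at `(0, x₀, y₀)` -/
  M : ℝ
  τ_pos : 0 < τ
  r_pos : 0 < r
  L_nonneg : 0 ≤ L
  ϱ_pos : 0 < ϱ

namespace ControlConstants

variable {E V : Type*} (b : ControlConstants E V)

/-- Bound for the distance of minimizers from the Slater point: beyond it, strong convexity and the
bound `C` on the unit ball force the objective above its value at the Slater point. -/
noncomputable def radius : ℝ := 1 + 4 * b.C / b.ϱ

/-- Bound for the right-hand side at `x₀`, over all times up to `τ` and all decisions in the ball of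
radius `b.radius` around the Slater point. -/
noncomputable def drift : ℝ := b.M + b.L * (b.τ + b.radius)

/-- Bound for the speed of the implicit Euler scheme with steps `h` such that `h * L ≤ 1 / 2`, as
long as it stays in the ball of states. -/
noncomputable def speed : ℝ := 2 * (b.drift + b.L * b.r)

end ControlConstants

namespace CoupledProgram

section Converges

variable {E V ι : Type*} [TopologicalSpace E] [TopologicalSpace V]

/-- Continuous convergence of all data of a family of coupled problems. -/
structure Converges {I : Type*} (l : Filter I) (D : I → CoupledProgram E V ι)
    (D' : CoupledProgram E V ι) : Prop where
  F : ContinuouslyConverges l (fun i => (D i).F) D'.F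
  G : ContinuouslyConverges l (fun i => (D i).G) D'.G
  c : ∀ k, ContinuouslyConverges l (fun i => (D i).c k) (D'.c k)

theorem Converges.comp {I J : Type*} {l : Filter I} {m : Filter J} {D : I → CoupledProgram E V ι}
    {D' : CoupledProgram E V ι} (h : Converges l D D') {i : J → I} (hi : Tendsto i m l) :
    Converges m (fun j => D (i j)) D' where
  F _ := h.F.comp (hi.comp tendsto_fst) tendsto_snd
  G _ := h.G.comp (hi.comp tendsto_fst) tendsto_snd
  c k _ := (h.c k).comp (hi.comp tendsto_fst) tendsto_snd

end Converges

variable {E V ι : Type*} [NormedAddCommGroup E] [NormedAddCommGroup V] [NormedSpace ℝ V]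

/-- The minimizers of the objective over the feasible set, for fixed time and state. -/
def solutions (D : CoupledProgram E V ι) (t : ℝ) (x : E) : Set V :=
  {y | (∀ i, D.c i (t, x, y) ≤ 0) ∧
    ∀ z, (∀ i, D.c i (t, x, z) ≤ 0) → D.G (t, x, y) ≤ D.G (t, x, z)}

/-- Lipschitz right-hand side, continuous and strongly convex objective, continuous and convex
constraints. -/
structure Regular (D : CoupledProgram E V ι) (L ϱ : ℝ) : Prop where
  lipschitz : ∀ z z' : ℝ × E × V, ‖D.F z - D.F z'‖ ≤
    L * (|z.1 - z'.1| + ‖z.2.1 - z'.2.1‖ + ‖z.2.2 - z'.2.2‖)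
  continuous_G : Continuous D.G
  strongConvex : ∀ t x y₁ y₂, ∀ τ ∈ Ioo (0 : ℝ) 1,
    D.G (t, x, (1 - τ) • y₁ + τ • y₂) ≤
      (1 - τ) * D.G (t, x, y₁) + τ * D.G (t, x, y₂) - 1 / 2 * ϱ * τ * (1 - τ) * ‖y₁ - y₂‖ ^ 2
  continuous_c : ∀ i, Continuous (D.c i)
  convex_c : ∀ i t x y₁ y₂, ∀ τ ∈ Ioo (0 : ℝ) 1,
    D.c i (t, x, (1 - τ) • y₁ + τ • y₂) ≤ (1 - τ) * D.c i (t, x, y₁) + τ * D.c i (t, x, y₂)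

/-- `D` is regular and obeys the bounds recorded in `b` on the region of times and states. -/
structure Controlled (D : CoupledProgram E V ι) (b : ControlConstants E V) : Prop where
  regular : D.Regular b.L b.ϱ
  slater : ∀ t ∈ Icc 0 b.τ, ∀ x ∈ Metric.closedBall b.x₀ b.r, ∀ i, D.c i (t, x, b.y₀) < 0
  bound_G : ∀ t ∈ Icc 0 b.τ, ∀ x ∈ Metric.closedBall b.x₀ b.r, ∀ y ∈ Metric.closedBall b.y₀ 1,
    |D.G (t, x, y)| ≤ b.C
  bound_F : ‖D.F (0, b.x₀, b.y₀)‖ ≤ b.M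

theorem Regular.continuous_F {D : CoupledProgram E V ι} {L ϱ : ℝ} (h : D.Regular L ϱ) :
    Continuous D.F := by
  rw [continuous_iff_continuousAt]
  intro z
  rw [ContinuousAt, tendsto_iff_norm_sub_tendsto_zero]
  refine squeeze_zero (fun _ => norm_nonneg _) (fun w => h.lipschitz w z) ?_
  have : Continuous fun w : ℝ × E × V =>
      L * (|w.1 - z.1| + ‖w.2.1 - z.2.1‖ + ‖w.2.2 - z.2.2‖) := by fun_prop
  simpa using this.tendsto z

section Controlled

variable {D : CoupledProgram E V ι} {b : ControlConstants E V} {t : ℝ} {x : E}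

theorem Controlled.C_nonneg (h : D.Controlled b) : 0 ≤ b.C :=
  (abs_nonneg _).trans (h.bound_G 0 ⟨le_rfl, b.τ_pos.le⟩ b.x₀ (Metric.mem_closedBall_self b.r_pos.le)
    b.y₀ (Metric.mem_closedBall_self zero_le_one))

theorem Controlled.radius_pos (h : D.Controlled b) : 0 < b.radius := by
  have := h.C_nonneg
  have := b.ϱ_pos
  unfold ControlConstants.radius
  positivity

/-- Strong convexity confines the sublevel set of the Slater point to a ball whose radius does not
depend on time and state. -/
theorem Controlled.norm_sub_le_radius (h : D.Controlled b) (ht : t ∈ Icc 0 b.τ)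
    (hx : x ∈ Metric.closedBall b.x₀ b.r) {y : V} (hy : D.G (t, x, y) ≤ D.G (t, x, b.y₀)) :
    ‖y - b.y₀‖ ≤ b.radius := by
  have hC := h.C_nonneg
  have hϱ := b.ϱ_pos
  have hR : 1 ≤ b.radius := by
    unfold ControlConstants.radius
    have : 0 ≤ 4 * b.C / b.ϱ := by positivity
    linarith
  rcases le_or_gt ‖y - b.y₀‖ 1 with h1 | h1
  · exact h1.trans hR
  set d := ‖y - b.y₀‖ with hd
  have hd0 : 0 < d := one_pos.trans h1
  have hτ : d⁻¹ ∈ Ioo (0 : ℝ) 1 := ⟨inv_pos.2 hd0, inv_lt_one_of_one_lt₀ h1⟩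
  -- the point at distance `1` from `y₀` on the segment towards `y`
  have hz : (1 - d⁻¹) • b.y₀ + d⁻¹ • y ∈ Metric.closedBall b.y₀ 1 := by
    rw [mem_closedBall_iff_norm]
    have : (1 - d⁻¹) • b.y₀ + d⁻¹ • y - b.y₀ = d⁻¹ • (y - b.y₀) := by module
    rw [this, norm_smul, Real.norm_of_nonneg hτ.1.le, ← hd, inv_mul_cancel₀ hd0.ne']
  have h2 := h.regular.strongConvex t x b.y₀ y _ hτ
  have h3 := (abs_le.1 (h.bound_G t ht x hx _ hz)).1
  have h4 := (abs_le.1 (h.bound_G t ht x hx b.y₀ (Metric.mem_closedBall_self zero_le_one))).2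
  rw [norm_sub_rev, ← hd] at h2
  have h5 : d⁻¹ * D.G (t, x, y) ≤ d⁻¹ * D.G (t, x, b.y₀) :=
    mul_le_mul_of_nonneg_left hy hτ.1.le
  have h6 : 1 / 2 * b.ϱ * d⁻¹ * (1 - d⁻¹) * d ^ 2 = 1 / 2 * b.ϱ * (d - 1) := by
    field_simp
  have h7 : b.ϱ * (d - 1) ≤ 4 * b.C := by nlinarith
  unfold ControlConstants.radius
  have h8 : d - 1 ≤ 4 * b.C / b.ϱ := by
    rw [le_div_iff₀ hϱ]; linarith
  linarith

theorem Controlled.slater_point_feasible (h : D.Controlled b) (ht : t ∈ Icc 0 b.τ)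
    (hx : x ∈ Metric.closedBall b.x₀ b.r) (i : ι) : D.c i (t, x, b.y₀) ≤ 0 :=
  (h.slater t ht x hx i).le

theorem Controlled.solutions_subset (h : D.Controlled b) (ht : t ∈ Icc 0 b.τ)
    (hx : x ∈ Metric.closedBall b.x₀ b.r) {y : V} (hy : y ∈ D.solutions t x) :
    ‖y - b.y₀‖ ≤ b.radius :=
  h.norm_sub_le_radius ht hx (hy.2 _ (h.slater_point_feasible ht hx))

theorem Controlled.solutions_nonempty [ProperSpace V] (h : D.Controlled b) (ht : t ∈ Icc 0 b.τ)
    (hx : x ∈ Metric.closedBall b.x₀ b.r) : (D.solutions t x).Nonempty := by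
  have hline : Continuous fun y : V => (t, x, y) := by fun_prop
  let K : Set V := {y | ∀ i, D.c i (t, x, y) ≤ 0} ∩ Metric.closedBall b.y₀ b.radius
  have hK : IsCompact K := by
    refine (isCompact_closedBall _ _).inter_left ?_
    rw [ofPred_forall]
    exact isClosed_iInter fun i =>
      isClosed_le ((h.regular.continuous_c i).comp hline) continuous_const
  have hy₀ : b.y₀ ∈ K :=
    ⟨h.slater_point_feasible ht hx, Metric.mem_closedBall_self h.radius_pos.le⟩
  obtain ⟨y, hyK, hy⟩ := hK.exists_isMinOn ⟨_, hy₀⟩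
    (h.regular.continuous_G.comp hline).continuousOn
  refine ⟨y, hyK.1, fun z hz => ?_⟩
  rcases le_total (D.G (t, x, z)) (D.G (t, x, b.y₀)) with hle | hle
  · exact hy ⟨hz, mem_closedBall_iff_norm.2 (h.norm_sub_le_radius ht hx hle)⟩
  · exact (hy hy₀).trans hle

theorem Regular.solutions_subsingleton {L ϱ : ℝ} (h : D.Regular L ϱ) (hϱ : 0 < ϱ) (t : ℝ) (x : E) :
    (D.solutions t x).Subsingleton := by
  intro y₁ h₁ y₂ h₂
  have hτ : (1 / 2 : ℝ) ∈ Ioo (0 : ℝ) 1 := by norm_num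
  have h3 := h.strongConvex t x y₁ y₂ _ hτ
  have hf : ∀ i, D.c i (t, x, (1 - 1 / 2 : ℝ) • y₁ + (1 / 2 : ℝ) • y₂) ≤ 0 := fun i => by
    have := h.convex_c i t x y₁ y₂ _ hτ
    linarith [h₁.1 i, h₂.1 i]
  have h4 := h₁.2 _ hf
  have h5 := h₂.2 _ h₁.1
  have h6 : ϱ * ‖y₁ - y₂‖ ^ 2 ≤ 0 := by linarith
  have h7 : ‖y₁ - y₂‖ ^ 2 ≤ 0 := by
    by_contra hc
    nlinarith
  exact sub_eq_zero.1 (norm_eq_zero.1 (pow_eq_zero_iff two_ne_zero |>.1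
    (le_antisymm h7 (sq_nonneg _))))

/-- The minimizer for given time and state, where there is one. -/
noncomputable def solution (D : CoupledProgram E V ι) (t : ℝ) (x : E) : V :=
  Classical.epsilon fun y => y ∈ D.solutions t x

theorem Controlled.solution_mem [ProperSpace V] (h : D.Controlled b) (ht : t ∈ Icc 0 b.τ)
    (hx : x ∈ Metric.closedBall b.x₀ b.r) : D.solution t x ∈ D.solutions t x :=
  Classical.epsilon_spec (h.solutions_nonempty ht hx)

theorem Controlled.norm_F_le (h : D.Controlled b) (ht : t ∈ Icc 0 b.τ) {y : V}
    (hy : ‖y - b.y₀‖ ≤ b.radius) (x : E) :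
    ‖D.F (t, x, y)‖ ≤ b.drift + b.L * ‖x - b.x₀‖ := by
  have h1 := h.regular.lipschitz (t, x, y) (0, b.x₀, b.y₀)
  have h2 := norm_le_norm_add_norm_sub' (D.F (t, x, y)) (D.F (0, b.x₀, b.y₀))
  have h3 := h.bound_F
  simp only [sub_zero, abs_of_nonneg ht.1] at h1
  have h4 : b.L * (t + ‖x - b.x₀‖ + ‖y - b.y₀‖) ≤ b.L * (b.τ + ‖x - b.x₀‖ + b.radius) := by
    have := b.L_nonneg
    have := ht.2
    gcongr
  unfold ControlConstants.drift
  linarith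

theorem Controlled.drift_nonneg (h : D.Controlled b) : 0 ≤ b.drift := by
  have := h.norm_F_le (t := 0) (y := b.y₀) ⟨le_rfl, b.τ_pos.le⟩ (by simpa using h.radius_pos.le) b.x₀
  simpa using (norm_nonneg _).trans this

theorem Controlled.speed_nonneg (h : D.Controlled b) : 0 ≤ b.speed := by
  have := h.drift_nonneg
  have := b.L_nonneg
  have := b.r_pos
  unfold ControlConstants.speed
  positivity

theorem Controlled.norm_F_le_speed (h : D.Controlled b) (ht : t ∈ Icc 0 b.τ)
    (hx : x ∈ Metric.closedBall b.x₀ b.r) {y : V} (hy : ‖y - b.y₀‖ ≤ b.radius) :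
    ‖D.F (t, x, y)‖ ≤ b.speed := by
  have h1 := h.norm_F_le ht hy x
  have h2 : b.L * ‖x - b.x₀‖ ≤ b.L * b.r :=
    mul_le_mul_of_nonneg_left (mem_closedBall_iff_norm.1 hx) b.L_nonneg
  have h3 := h.drift_nonneg
  have h4 : 0 ≤ b.L * b.r := mul_nonneg b.L_nonneg b.r_pos.le
  unfold ControlConstants.speed
  linarith

end Controlled

theorem Regular.converges_const {I : Type*} (l : Filter I) {D : CoupledProgram E V ι} {L ϱ : ℝ}
    (h : D.Regular L ϱ) : Converges l (fun _ => D) D where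
  F z := (h.continuous_F.tendsto z).comp tendsto_snd
  G z := (h.continuous_G.tendsto z).comp tendsto_snd
  c k z := ((h.continuous_c k).tendsto z).comp tendsto_snd

/-- Stability of the minimizer: it converges when the data converge continuously and time and
state converge. Cluster points of the minimizers are feasible, and comparison with the strictly
feasible points `(1 - θ) y + θ y₀`, `θ → 0`, shows that they are optimal. -/
theorem Converges.tendsto_solutions [ProperSpace V] [Finite ι] {I : Type*} {l : Filter I}
    {D : I → CoupledProgram E V ι} {D' : CoupledProgram E V ι} (hD : Converges l D D')
    {b : ControlConstants E V} (hb : ∀ᶠ i in l, (D i).Controlled b) (hb' : D'.Controlled b)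
    {t : I → ℝ} {x : I → E} {t' : ℝ} {x' : E} (htl : ∀ᶠ i in l, t i ∈ Icc 0 b.τ)
    (hxl : ∀ᶠ i in l, x i ∈ Metric.closedBall b.x₀ b.r) (ht : Tendsto t l (𝓝 t'))
    (hx : Tendsto x l (𝓝 x')) (ht' : t' ∈ Icc 0 b.τ) (hx' : x' ∈ Metric.closedBall b.x₀ b.r)
    {y : I → V} {y' : V} (hy : ∀ᶠ i in l, y i ∈ (D i).solutions (t i) (x i))
    (hy' : y' ∈ D'.solutions t' x') : Tendsto y l (𝓝 y') := by
  have hmem : ∀ᶠ i in l, y i ∈ Metric.closedBall b.y₀ b.radius := by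
    filter_upwards [hb, htl, hxl, hy] with i h1 h2 h3 h4
    exact mem_closedBall_iff_norm.2 (h1.solutions_subset h2 h3 h4)
  refine (isCompact_closedBall b.y₀ b.radius).tendsto_nhds_of_unique_mapClusterPt hmem
    fun w _ hw => ?_
  obtain ⟨u, hul, hu⟩ := mapClusterPt_iff_ultrafilter.1 hw
  have hid : Tendsto (fun i : I => i) u l := hul
  have htu := ht.mono_left hul
  have hxu := hx.mono_left hul
  have hyu := hy.filter_mono hul
  refine hb'.regular.solutions_subsingleton b.ϱ_pos t' x' ⟨fun k => ?_, fun z hz => ?_⟩ hy'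
  · refine le_of_tendsto ((hD.c k).comp hid (htu.prodMk_nhds (hxu.prodMk_nhds hu))) ?_
    filter_upwards [hyu] with i hi using hi.1 k
  · refine le_trans ?_ (hy'.2 z hz)
    have hθ : ∀ θ ∈ Ioo (0 : ℝ) 1,
        D'.G (t', x', w) ≤ D'.G (t', x', (1 - θ) • y' + θ • b.y₀) := by
      intro θ hθ
      have hstrict : ∀ k, D'.c k (t', x', (1 - θ) • y' + θ • b.y₀) < 0 := fun k => by
        have h1 := hb'.regular.convex_c k t' x' y' b.y₀ θ hθ
        have h2 := hb'.slater t' ht' x' hx' k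
        have h3 := hy'.1 k
        have h4 := hθ.1
        have h5 := hθ.2
        nlinarith
      have hev : ∀ᶠ i in (u : Filter I),
          ∀ k, (D i).c k (t i, x i, (1 - θ) • y' + θ • b.y₀) ≤ 0 := by
        rw [eventually_all]
        intro k
        have := (hD.c k).comp hid (htu.prodMk_nhds (hxu.prodMk_nhds
          (tendsto_const_nhds (x := (1 - θ) • y' + θ • b.y₀))))
        exact (this.eventually (gt_mem_nhds (hstrict k))).mono fun i hi => hi.le
      refine le_of_tendsto_of_tendsto (hD.G.comp hid (htu.prodMk_nhds (hxu.prodMk_nhds hu)))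
        (hD.G.comp hid (htu.prodMk_nhds (hxu.prodMk_nhds
          (tendsto_const_nhds (x := (1 - θ) • y' + θ • b.y₀))))) ?_
      filter_upwards [hyu, hev] with i h1 h2 using h1.2 _ h2
    have hlim : Tendsto (fun θ : ℝ => D'.G (t', x', (1 - θ) • y' + θ • b.y₀)) (𝓝[>] 0)
        (𝓝 (D'.G (t', x', y'))) := by
      have hc : Continuous fun θ : ℝ => D'.G (t', x', (1 - θ) • y' + θ • b.y₀) :=
        hb'.regular.continuous_G.comp (by fun_prop)
      have := (hc.tendsto 0).mono_left (nhdsWithin_le_nhds (s := Ioi 0))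
      simpa using this
    refine ge_of_tendsto hlim ?_
    filter_upwards [Ioo_mem_nhdsGT one_pos] with θ h using hθ θ h

end CoupledProgram

/-! ### The implicit Euler scheme -/

section StepIndex

variable {h t : ℝ}

theorem stepIndex_eq (hh : 0 < h) {i : ℕ} (ht : t ∈ Ioc (i * h) ((i + 1) * h)) :
    stepIndex h t = i := by
  have : ⌈t / h⌉₊ = i + 1 := by
    rw [Nat.ceil_eq_iff (Nat.succ_ne_zero i)]
    push_cast [Nat.add_sub_cancel]
    exact ⟨(lt_div_iff₀ hh).2 ht.1, (div_le_iff₀ hh).2 ht.2⟩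
  simp [stepIndex, this]

theorem mem_Ioc_stepIndex (hh : 0 < h) (ht : 0 < t) :
    t ∈ Ioc (stepIndex h t * h) ((stepIndex h t + 1) * h) := by
  have h0 : 0 < ⌈t / h⌉₊ := Nat.ceil_pos.2 (div_pos ht hh)
  obtain ⟨i, hi⟩ := Nat.exists_eq_succ_of_ne_zero h0.ne'
  have h1 := (Nat.ceil_eq_iff (Nat.succ_ne_zero i)).1 hi
  simp only [Nat.succ_eq_add_one, Nat.add_sub_cancel, Nat.cast_add, Nat.cast_one] at h1
  have h2 : stepIndex h t = i := by simp [stepIndex, hi]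
  rw [h2]
  exact ⟨(lt_div_iff₀ hh).1 h1.1, (div_le_iff₀ hh).1 h1.2⟩

theorem stepIndex_lt (hh : 0 < h) (ht : 0 < t) {N : ℕ} (htN : t ≤ N * h) : stepIndex h t < N := by
  have h1 := (mem_Ioc_stepIndex hh ht).1.trans_le htN
  exact_mod_cast lt_of_mul_lt_mul_right h1 hh.le

theorem measurable_stepIndex (h : ℝ) : Measurable (stepIndex h) := by
  have : Measurable fun t : ℝ => ⌈t / h⌉₊ := Nat.measurable_ceil.comp (measurable_id.div_const h)
  exact (measurable_from_top (f := fun k : ℕ => k - 1)).comp this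

variable {E : Type*} [NormedAddCommGroup E]

theorem stronglyMeasurable_constantInterpolant (h : ℝ) (Y : ℕ → E) :
    StronglyMeasurable (constantInterpolant h Y) :=
  (StronglyMeasurable.of_discrete (f := fun i => Y (i + 1))).comp_measurable
    (measurable_stepIndex h)

variable [NormedSpace ℝ E]

theorem linearInterpolant_zero (h : ℝ) (X : ℕ → E) : linearInterpolant h X 0 = X 0 := by
  simp [linearInterpolant, stepIndex]

theorem norm_linearInterpolant_sub_le (hh : 0 < h) (ht : 0 < t) (X : ℕ → E) :
    ‖linearInterpolant h X t - X (stepIndex h t)‖ ≤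
      ‖X (stepIndex h t + 1) - X (stepIndex h t)‖ := by
  have h1 := mem_Ioc_stepIndex hh ht
  rw [linearInterpolant, add_sub_cancel_left, norm_smul, Real.norm_of_nonneg
    (div_nonneg (by linarith [h1.1]) hh.le)]
  refine mul_le_of_le_one_left (norm_nonneg _) ((div_le_one hh).2 ?_)
  linarith [h1.2]

theorem constantInterpolant_integral_step [CompleteSpace E] (hh : 0 < h) (W : ℕ → E) (i : ℕ)
    {a : ℝ} (ha : a ∈ Icc (i * h) ((i + 1) * h)) :
    IntervalIntegrable (constantInterpolant h W) volume (i * h) a ∧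
      ∫ s in (i * h)..a, constantInterpolant h W s = (a - i * h) • W (i + 1) := by
  have heq : ∀ s ∈ Ioc (i * h) a, constantInterpolant h W s = W (i + 1) := fun s hs => by
    rw [constantInterpolant, stepIndex_eq hh ⟨hs.1, hs.2.trans ha.2⟩]
  constructor
  · refine (intervalIntegrable_const (c := W (i + 1))).congr ?_
    rw [uIoc_of_le ha.1]
    exact fun s hs => (heq s hs).symm
  · rw [← intervalIntegral.integral_const]
    refine intervalIntegral.integral_congr_ae (Eventually.of_forall ?_)
    rw [uIoc_of_le ha.1]
    exact heq

/-- The piecewise linear interpolant is the integral of the piecewise constant interpolant of its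
slopes. -/
theorem linearInterpolant_eq_integral [CompleteSpace E] (hh : 0 < h) {N : ℕ} {X W : ℕ → E}
    (hX : ∀ i < N, X (i + 1) = X i + h • W (i + 1)) (ht : t ∈ Icc 0 (N * h)) :
    IntervalIntegrable (constantInterpolant h W) volume 0 t ∧
      linearInterpolant h X t = X 0 + ∫ s in 0..t, constantInterpolant h W s := by
  have grid : ∀ i ≤ N, IntervalIntegrable (constantInterpolant h W) volume 0 (i * h) ∧
      X i = X 0 + ∫ s in 0..(i * h), constantInterpolant h W s := by
    intro i
    induction i with
    | zero => simp
    | succ i ih =>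
      intro hi
      obtain ⟨h1, h2⟩ := ih (by omega)
      obtain ⟨h3, h4⟩ := constantInterpolant_integral_step hh W i (a := (i + 1) * h)
        ⟨by nlinarith, le_rfl⟩
      push_cast
      refine ⟨h1.trans h3, ?_⟩
      rw [← intervalIntegral.integral_add_adjacent_intervals h1 h3, h4, ← add_assoc, ← h2,
        hX i (by omega)]
      congr 2
      ring
  rcases ht.1.eq_or_lt with rfl | ht0
  · simp [linearInterpolant_zero]
  · have hmem := mem_Ioc_stepIndex hh ht0
    have hlt := stepIndex_lt hh ht0 ht.2
    obtain ⟨h1, h2⟩ := grid _ hlt.le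
    obtain ⟨h3, h4⟩ := constantInterpolant_integral_step hh W _ ⟨hmem.1.le, hmem.2⟩
    refine ⟨h1.trans h3, ?_⟩
    rw [← intervalIntegral.integral_add_adjacent_intervals h1 h3, h4, ← add_assoc, ← h2,
      linearInterpolant, hX _ hlt, add_sub_cancel_left, smul_smul, div_mul_cancel₀ _ hh.ne']

end StepIndex

namespace CoupledProgram

section Admissible

variable {E V : Type*} {b : ControlConstants E V} {T : ℝ} {N : ℕ}

/-- The horizon `T` and the number of steps `N` are such that the scheme cannot leave the region
controlled by `b`, and every implicit step is a contraction. -/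
structure Admissible (b : ControlConstants E V) (T : ℝ) (N : ℕ) : Prop where
  T_pos : 0 < T
  T_le : T ≤ b.τ
  speed_le : T * b.speed ≤ b.r
  N_pos : 0 < N
  step_le : T / N * b.L ≤ 1 / 2

theorem Admissible.step_pos (hT : Admissible b T N) : 0 < T / N :=
  div_pos hT.T_pos (Nat.cast_pos.2 hT.N_pos)

theorem Admissible.mul_step_eq (hT : Admissible b T N) : N * (T / N) = T :=
  mul_div_cancel₀ _ (Nat.cast_ne_zero.2 hT.N_pos.ne')

theorem Admissible.mul_step_le (hT : Admissible b T N) {i : ℕ} (hi : i ≤ N) :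
    i * (T / N) ≤ T := by
  have h1 : (i : ℝ) * (T / N) ≤ N * (T / N) :=
    mul_le_mul_of_nonneg_right (Nat.cast_le.2 hi) hT.step_pos.le
  rwa [hT.mul_step_eq] at h1

theorem Admissible.grid_mem (hT : Admissible b T N) {i : ℕ} (hi : i ≤ N) :
    (i : ℝ) * (T / N) ∈ Icc 0 b.τ :=
  ⟨mul_nonneg (Nat.cast_nonneg _) hT.step_pos.le, (hT.mul_step_le hi).trans hT.T_le⟩

theorem Admissible.mem_closedBall_of_norm_le [NormedAddCommGroup E] (hT : Admissible b T N)
    (hb : 0 ≤ b.speed) {i : ℕ} (hi : i ≤ N) {x : E} (hx : ‖x - b.x₀‖ ≤ i * (T / N) * b.speed) :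
    x ∈ Metric.closedBall b.x₀ b.r :=
  mem_closedBall_iff_norm.2 (hx.trans
    ((mul_le_mul_of_nonneg_right (hT.mul_step_le hi) hb).trans hT.speed_le))

theorem Admissible.stepIndex_lt (hT : Admissible b T N) {t : ℝ} (ht : t ∈ Ioc 0 T) :
    stepIndex (T / N) t < N :=
  _root_.stepIndex_lt hT.step_pos ht.1 (by rw [hT.mul_step_eq]; exact ht.2)

end Admissible

variable {E V ι : Type*} [NormedAddCommGroup E] [NormedSpace ℝ E]

/-- Solutions of the semi-implicit Euler scheme with `N` steps on `[0, T]` for the problem `D`. -/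
structure SchemeSolution (D : CoupledProgram E V ι) (x₀ : E) (T : ℝ) (N : ℕ)
    (X : ℕ → E) (Y : ℕ → V) : Prop where
  init : X 0 = x₀
  state_step : ∀ i < N, X (i + 1) = X i +
    (T / N) • D.F ((i + 1 : ℕ) * (T / N), X (i + 1), Y (i + 1))
  argmin_step : ∀ i < N, Y (i + 1) ∈ D.solutions ((i + 1 : ℕ) * (T / N)) (X i)

section Scheme

variable {D : CoupledProgram E V ι} {b : ControlConstants E V} {T : ℝ} {N : ℕ}

/-- The interpolated states of the scheme are an integral of the piecewise constant
right-hand sides. -/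
theorem SchemeSolution.linearInterpolant_eq [CompleteSpace E] {X : ℕ → E} {Y : ℕ → V}
    (hS : D.SchemeSolution b.x₀ T N X Y) (hT : Admissible b T N) {t : ℝ} (ht : t ∈ Icc 0 T) :
    IntervalIntegrable
      (constantInterpolant (T / N) fun i => D.F (i * (T / N), X i, Y i)) volume 0 t ∧
    linearInterpolant (T / N) X t = b.x₀ +
      ∫ s in 0..t, constantInterpolant (T / N) (fun i => D.F (i * (T / N), X i, Y i)) s := by
  have := linearInterpolant_eq_integral (X := X) (W := fun i => D.F (i * (T / N), X i, Y i))
    hT.step_pos hS.state_step (t := t) (by rwa [hT.mul_step_eq])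
  rwa [hS.init] at this

variable [NormedAddCommGroup V] [NormedSpace ℝ V]

/-- An implicit step moves the state by at most the step size times `b.speed`. The implicit state is
not known to lie in the ball beforehand; the condition `k * b.L ≤ 1 / 2` absorbs its distance from
the old state. -/
theorem Controlled.norm_step_le (h : D.Controlled b) {k t : ℝ} (hk : 0 ≤ k) (hkL : k * b.L ≤ 1 / 2)
    (ht : t ∈ Icc 0 b.τ) {x x' : E} (hx : x ∈ Metric.closedBall b.x₀ b.r) {y : V}
    (hy : ‖y - b.y₀‖ ≤ b.radius) (hx' : x' = x + k • D.F (t, x', y)) :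
    ‖x' - x‖ ≤ k * b.speed := by
  have h1 : ‖x' - x‖ = k * ‖D.F (t, x', y)‖ := by
    nth_rewrite 1 [hx']
    rw [add_sub_cancel_left, norm_smul, Real.norm_of_nonneg hk]
  have h2 := h.norm_F_le ht hy x'
  have h3 : ‖x' - b.x₀‖ ≤ ‖x' - x‖ + b.r :=
    (norm_sub_le_norm_sub_add_norm_sub _ x _).trans
      (add_le_add_right (mem_closedBall_iff_norm.1 hx) _)
  have h4 : ‖D.F (t, x', y)‖ ≤ b.drift + b.L * (‖x' - x‖ + b.r) :=
    h2.trans (add_le_add_right (mul_le_mul_of_nonneg_left h3 b.L_nonneg) _)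
  have h5 := mul_le_mul_of_nonneg_left h4 hk
  have h6 := mul_le_mul_of_nonneg_right hkL (norm_nonneg (x' - x))
  unfold ControlConstants.speed
  linarith

theorem SchemeSolution.norm_state_sub_le {X : ℕ → E} {Y : ℕ → V}
    (hS : D.SchemeSolution b.x₀ T N X Y) (h : D.Controlled b) (hT : Admissible b T N) :
    ∀ i ≤ N, ‖X i - b.x₀‖ ≤ i * (T / N) * b.speed := by
  intro i
  induction i with
  | zero => simp [hS.init]
  | succ i ih =>
    intro hi
    have h1 := ih (by omega)
    have hx := hT.mem_closedBall_of_norm_le h.speed_nonneg (by omega) h1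
    have ht := hT.grid_mem hi
    have h2 := h.norm_step_le hT.step_pos.le hT.step_le ht hx
      (h.solutions_subset ht hx (hS.argmin_step i hi)) (hS.state_step i hi)
    have h3 := norm_sub_le_norm_sub_add_norm_sub (X (i + 1)) (X i) b.x₀
    push_cast
    linarith

theorem SchemeSolution.state_mem {X : ℕ → E} {Y : ℕ → V}
    (hS : D.SchemeSolution b.x₀ T N X Y) (h : D.Controlled b) (hT : Admissible b T N) {i : ℕ}
    (hi : i ≤ N) : X i ∈ Metric.closedBall b.x₀ b.r :=
  hT.mem_closedBall_of_norm_le h.speed_nonneg hi (hS.norm_state_sub_le h hT i hi)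

theorem SchemeSolution.norm_decision_sub_le {X : ℕ → E} {Y : ℕ → V}
    (hS : D.SchemeSolution b.x₀ T N X Y) (h : D.Controlled b) (hT : Admissible b T N) {i : ℕ}
    (hi : i < N) : ‖Y (i + 1) - b.y₀‖ ≤ b.radius :=
  h.solutions_subset (hT.grid_mem hi) (hS.state_mem h hT hi.le) (hS.argmin_step i hi)

theorem SchemeSolution.norm_step_le {X : ℕ → E} {Y : ℕ → V}
    (hS : D.SchemeSolution b.x₀ T N X Y) (h : D.Controlled b) (hT : Admissible b T N) {i : ℕ}
    (hi : i < N) : ‖X (i + 1) - X i‖ ≤ T / N * b.speed :=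
  h.norm_step_le hT.step_pos.le hT.step_le (hT.grid_mem hi) (hS.state_mem h hT hi.le)
    (hS.norm_decision_sub_le h hT hi) (hS.state_step i hi)

/-- The implicit step has a solution, as the fixed point of a contraction. -/
theorem Regular.exists_implicit_step [CompleteSpace E] {L ϱ : ℝ} (h : D.Regular L ϱ) {k : ℝ}
    (hk : 0 ≤ k) (hkL : k * L ≤ 1 / 2) (t : ℝ) (x : E) (y : V) :
    ∃ x', x' = x + k • D.F (t, x', y) := by
  have hc : ContractingWith (1 / 2 : ℝ≥0) fun x' => x + k • D.F (t, x', y) := by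
    refine ⟨by norm_num [← NNReal.coe_lt_coe], LipschitzWith.of_dist_le_mul fun u v => ?_⟩
    rw [dist_add_left, dist_eq_norm, ← smul_sub, norm_smul, Real.norm_of_nonneg hk, dist_eq_norm]
    have h1 := h.lipschitz (t, u, y) (t, v, y)
    simp only [sub_self, abs_zero, norm_zero, zero_add, add_zero] at h1
    have h2 := mul_le_mul_of_nonneg_left h1 hk
    have h3 := mul_le_mul_of_nonneg_right hkL (norm_nonneg (u - v))
    push_cast
    linarith
  exact ⟨_, hc.fixedPoint_isFixedPt.symm⟩

theorem Controlled.exists_schemeSolution [CompleteSpace E] [ProperSpace V] (h : D.Controlled b)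
    (hT : Admissible b T N) : ∃ X Y, D.SchemeSolution b.x₀ T N X Y := by
  have hstep : ∀ (i : ℕ) (x : E), ∃ x', x' = x + (T / N) •
      D.F ((i + 1 : ℕ) * (T / N), x', D.solution ((i + 1 : ℕ) * (T / N)) x) := fun i x =>
    h.regular.exists_implicit_step hT.step_pos.le hT.step_le _ _ _
  choose next hnext using hstep
  let X : ℕ → E := fun i => Nat.rec b.x₀ next i
  have hX : ∀ i, X (i + 1) = next i (X i) := fun i => rfl
  have hmem : ∀ i ≤ N, ‖X i - b.x₀‖ ≤ i * (T / N) * b.speed := by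
    intro i
    induction i with
    | zero => simp [X]
    | succ i ih =>
      intro hi
      have h1 := ih (by omega)
      have hx := hT.mem_closedBall_of_norm_le h.speed_nonneg (by omega) h1
      have ht := hT.grid_mem hi
      have h2 := h.norm_step_le hT.step_pos.le hT.step_le ht hx
        (h.solutions_subset ht hx (h.solution_mem ht hx)) (hnext i (X i))
      have h3 := norm_sub_le_norm_sub_add_norm_sub (X (i + 1)) (X i) b.x₀
      rw [← hX] at h2
      push_cast
      linarith
  exact ⟨X, fun i => D.solution (i * (T / N)) (X (i - 1)), rfl, fun i _ => hnext i (X i),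
    fun i hi => h.solution_mem (hT.grid_mem hi)
      (hT.mem_closedBall_of_norm_le h.speed_nonneg hi.le (hmem i hi.le))⟩

theorem SchemeSolution.norm_rhs_le {X : ℕ → E} {Y : ℕ → V}
    (hS : D.SchemeSolution b.x₀ T N X Y) (h : D.Controlled b) (hT : Admissible b T N) {t : ℝ}
    (ht : t ∈ Ioc 0 T) :
    ‖constantInterpolant (T / N) (fun i => D.F (i * (T / N), X i, Y i)) t‖ ≤ b.speed := by
  have hi := Admissible.stepIndex_lt hT ht
  exact h.norm_F_le_speed (hT.grid_mem hi) (hS.state_mem h hT hi)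
    (hS.norm_decision_sub_le h hT hi)

/-- The interpolated states of all schemes share the Lipschitz constant `b.speed`. -/
theorem SchemeSolution.norm_linearInterpolant_sub_le [CompleteSpace E] {X : ℕ → E} {Y : ℕ → V}
    (hS : D.SchemeSolution b.x₀ T N X Y) (h : D.Controlled b) (hT : Admissible b T N) {s t : ℝ}
    (hs : s ∈ Icc 0 T) (ht : t ∈ Icc 0 T) :
    ‖linearInterpolant (T / N) X t - linearInterpolant (T / N) X s‖ ≤ b.speed * |t - s| := by
  obtain ⟨h1, h2⟩ := hS.linearInterpolant_eq hT hs
  obtain ⟨h3, h4⟩ := hS.linearInterpolant_eq hT ht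
  rw [h2, h4, add_sub_add_left_eq_sub, intervalIntegral.integral_interval_sub_left h3 h1]
  refine intervalIntegral.norm_integral_le_of_norm_le_const fun w hw => hS.norm_rhs_le h hT ?_
  rw [uIoc, mem_Ioc] at hw
  exact ⟨(le_min hs.1 ht.1).trans_lt hw.1, hw.2.trans (max_le hs.2 ht.2)⟩

end Scheme

end CoupledProgram

/-! ### Passage to the limit -/

/-- Dominated convergence for `L²` norms on a finite measure space. -/
theorem tendsto_eLpNorm_two_of_bounded {α V : Type*} [MeasurableSpace α] {μ : Measure α}
    [IsFiniteMeasure μ] [NormedAddCommGroup V] {w : ℕ → α → V} {w' : α → V} (R : ℝ)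
    (hm : ∀ᶠ j in atTop, AEStronglyMeasurable (w j) μ)
    (hR : ∀ᶠ j in atTop, ∀ᵐ a ∂μ, ‖w j a‖ ≤ R)
    (hw : ∀ᵐ a ∂μ, Tendsto (fun j => w j a) atTop (𝓝 (w' a))) :
    Tendsto (fun j => eLpNorm (w j) 2 μ) atTop (𝓝 (eLpNorm w' 2 μ)) := by
  simp only [eLpNorm_eq_lintegral_rpow_enorm_toReal two_ne_zero ENNReal.ofNat_ne_top]
  refine (ENNReal.continuous_rpow_const.tendsto _).comp ?_
  refine tendsto_lintegral_filter_of_dominated_convergence'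
    (fun _ => ENNReal.ofReal R ^ (2 : ℝ≥0∞).toReal) ?_ ?_ ?_ ?_
  · filter_upwards [hm] with j hj using hj.enorm.pow_const _
  · filter_upwards [hR] with j hj
    filter_upwards [hj] with a ha
    refine ENNReal.rpow_le_rpow ?_ (by norm_num)
    rw [← ofReal_norm]
    exact ENNReal.ofReal_le_ofReal ha
  · rw [lintegral_const]
    exact ENNReal.mul_ne_top (by simp) (measure_ne_top _ _)
  · filter_upwards [hw] with a ha
    exact (ENNReal.continuous_rpow_const.tendsto _).comp ha.enorm

namespace CoupledProgram

/-- The state paths on `[0, T]` that take values in the ball of `b` and have the Lipschitz constant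
`b.speed`. -/
def statePaths {E V : Type*} [NormedAddCommGroup E] (b : ControlConstants E V) (T : ℝ) :
    Set C(Icc 0 T, E) :=
  {f | LipschitzWith b.speed.toNNReal f ∧ ∀ t, f t ∈ Metric.closedBall b.x₀ b.r}

/-- The set of state paths is compact, by the Arzelà–Ascoli theorem. -/
theorem isCompact_statePaths {E V : Type*} [NormedAddCommGroup E] [ProperSpace E]
    (b : ControlConstants E V) (T : ℝ) :
    IsCompact (statePaths b T) := by
  refine ArzelaAscoli.isCompact_of_equicontinuous _ ?_ ?_
  · have himage : ContinuousMap.toFun '' statePaths b T =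
        {f : Icc 0 T → E | LipschitzWith b.speed.toNNReal f} ∩
          Set.pi univ fun _ => Metric.closedBall b.x₀ b.r := by
      ext f
      constructor
      · rintro ⟨g, hg, rfl⟩
        exact ⟨hg.1, fun t _ => hg.2 t⟩
      · rintro ⟨h1, h2⟩
        exact ⟨⟨f, LipschitzWith.continuous h1⟩, ⟨h1, fun t => h2 t trivial⟩, rfl⟩
    rw [himage]
    refine (isCompact_univ_pi fun _ => isCompact_closedBall _ _).inter_left ?_
    exact isClosed_setOfPred_lipschitzWith _
  · exact (LipschitzWith.uniformEquicontinuous _ b.speed.toNNReal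
      fun f : statePaths b T => f.2.1).equicontinuous

variable {E V ι : Type*} [NormedAddCommGroup E] [NormedAddCommGroup V] [NormedSpace ℝ V]

variable [ProperSpace V] [Finite ι] {D' : CoupledProgram E V ι} {b : ControlConstants E V} {T : ℝ}

theorem Controlled.continuousOn_solution (h : D'.Controlled b) (hT : T ≤ b.τ) {u : ℝ → E}
    (hu : ContinuousOn u (Icc 0 T)) (hmem : ∀ t ∈ Icc 0 T, u t ∈ Metric.closedBall b.x₀ b.r) :
    ContinuousOn (fun t => D'.solution t (u t)) (Icc 0 T) := by
  intro t ht
  have hsub : ∀ s ∈ Icc 0 T, s ∈ Icc 0 b.τ := fun s hs => ⟨hs.1, hs.2.trans hT⟩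
  have hev : ∀ᶠ s in 𝓝[Icc 0 T] t, s ∈ Icc 0 T := self_mem_nhdsWithin
  exact (h.regular.converges_const (𝓝[Icc 0 T] t)).tendsto_solutions
    (Eventually.of_forall fun _ => h) h (t := fun s => s) (x := u)
    (hev.mono hsub) (hev.mono hmem) (tendsto_id.mono_left nhdsWithin_le_nhds)
    (hu t ht) (hsub t ht) (hmem t ht)
    (hev.mono fun s hs => h.solution_mem (hsub s hs) (hmem s hs))
    (h.solution_mem (hsub t ht) (hmem t ht))

theorem Controlled.continuousOn_rhs (h : D'.Controlled b) (hT : T ≤ b.τ) {u : ℝ → E}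
    (hu : ContinuousOn u (Icc 0 T)) (hmem : ∀ t ∈ Icc 0 T, u t ∈ Metric.closedBall b.x₀ b.r) :
    ContinuousOn (fun s => D'.F (s, u s, D'.solution s (u s))) (Icc 0 T) :=
  h.regular.continuous_F.comp_continuousOn
    (continuousOn_id.prodMk (hu.prodMk (h.continuousOn_solution hT hu hmem)))

theorem aestronglyMeasurable_uIoc_of_continuousOn {W : Type*} [NormedAddCommGroup W] {f : ℝ → W}
    {t : ℝ} (hf : ContinuousOn f (Icc 0 T)) (ht : t ∈ Icc 0 T) :
    AEStronglyMeasurable f (volume.restrict (uIoc 0 t)) := by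
  rw [uIoc_of_le ht.1]
  exact (hf.aestronglyMeasurable measurableSet_Icc).mono_set
    (Ioc_subset_Icc_self.trans (Icc_subset_Icc_right ht.2))

/-- When the problems converge and the states converge, so do the minimizers. -/
theorem Converges.tendsto_solution {D : ℕ → CoupledProgram E V ι}
    {u : ℕ → ℝ → E} {u' : ℝ → E} (hD : Converges atTop D D')
    (hb : ∀ᶠ k in atTop, (D k).Controlled b) (hb' : D'.Controlled b) (hT : T ≤ b.τ)
    (hu : ∀ᶠ k in atTop, ∀ t ∈ Icc 0 T, u k t ∈ Metric.closedBall b.x₀ b.r)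
    (hmem : ∀ t ∈ Icc 0 T, u' t ∈ Metric.closedBall b.x₀ b.r)
    {t : ℝ} (ht : t ∈ Icc 0 T) (hlim : Tendsto (fun k => u k t) atTop (𝓝 (u' t))) :
    Tendsto (fun k => (D k).solution t (u k t)) atTop (𝓝 (D'.solution t (u' t))) := by
  have htτ : t ∈ Icc 0 b.τ := ⟨ht.1, ht.2.trans hT⟩
  refine hD.tendsto_solutions hb hb' (Eventually.of_forall fun _ => htτ)
    (hu.mono fun k hk => hk t ht) tendsto_const_nhds hlim htτ (hmem t ht) ?_
    (hb'.solution_mem htτ (hmem t ht))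
  filter_upwards [hb, hu] with k hk hk' using hk.solution_mem htτ (hk' t ht)

variable [NormedSpace ℝ E]

/-- A continuous solution of the integral equation on `[0, T]`, with the minimizer as decision, that
stays in the region controlled by `b`. -/
structure IsTrajectory (D : CoupledProgram E V ι) (b : ControlConstants E V) (T : ℝ)
    (u : ℝ → E) : Prop where
  continuousOn : ContinuousOn u (Icc 0 T)
  mem : ∀ t ∈ Icc 0 T, u t ∈ Metric.closedBall b.x₀ b.r
  integral_eq : ∀ t ∈ Icc 0 T, u t = b.x₀ + ∫ s in 0..t, D.F (s, u s, D.solution s (u s))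

section FixedProblem

variable {N : ℕ → ℕ} {X : ℕ → ℕ → E} {Y : ℕ → ℕ → V} {u : ℝ → E}

/-- For a fixed problem, if the interpolated states converge as the step size tends to `0`, so do
the grid time, the two neighbouring grid states and the decision. -/
theorem Controlled.tendsto_scheme (h : D'.Controlled b) (hN : Tendsto N atTop atTop)
    (hA : ∀ᶠ j in atTop, Admissible b T (N j))
    (hS : ∀ᶠ j in atTop, D'.SchemeSolution b.x₀ T (N j) (X j) (Y j))
    (hmem : ∀ t ∈ Icc 0 T, u t ∈ Metric.closedBall b.x₀ b.r)
    (hlim : ∀ t ∈ Icc 0 T,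
      Tendsto (fun j => linearInterpolant (T / N j) (X j) t) atTop (𝓝 (u t)))
    {t : ℝ} (ht : t ∈ Ioc 0 T) :
    Tendsto (fun j => constantInterpolant (T / N j) (Y j) t) atTop (𝓝 (D'.solution t (u t))) ∧
    Tendsto (fun j => constantInterpolant (T / N j)
      (fun i => D'.F (i * (T / N j), X j i, Y j i)) t) atTop
      (𝓝 (D'.F (t, u t, D'.solution t (u t)))) := by
  have ht' : t ∈ Icc 0 T := ⟨ht.1.le, ht.2⟩
  have hh : Tendsto (fun j => T / (N j : ℝ)) atTop (𝓝 0) :=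
    tendsto_const_nhds.div_atTop (tendsto_natCast_atTop_atTop.comp hN)
  have htime : Tendsto (fun j => ((stepIndex (T / N j) t + 1 : ℕ) : ℝ) * (T / N j)) atTop
      (𝓝 t) := by
    refine tendsto_of_tendsto_of_tendsto_of_le_of_le' tendsto_const_nhds
      (by simpa using hh.const_add t) ?_ ?_
    · filter_upwards [hA] with j hj
      have := (mem_Ioc_stepIndex hj.step_pos ht.1).2
      push_cast
      exact this
    · filter_upwards [hA] with j hj
      have := (mem_Ioc_stepIndex hj.step_pos ht.1).1
      push_cast
      linarith
  have hhs : Tendsto (fun j => T / (N j : ℝ) * b.speed) atTop (𝓝 0) := by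
    simpa using hh.mul_const b.speed
  have hleft : Tendsto (fun j => X j (stepIndex (T / N j) t)) atTop (𝓝 (u t)) := by
    refine tendsto_of_tendsto_of_dist (hlim t ht') ?_
    refine squeeze_zero' (Eventually.of_forall fun _ => dist_nonneg) ?_ hhs
    filter_upwards [hA, hS] with j hj hs
    rw [dist_eq_norm]
    exact (norm_linearInterpolant_sub_le hj.step_pos ht.1 _).trans
      (hs.norm_step_le h hj (hj.stepIndex_lt ht))
  have hright : Tendsto (fun j => X j (stepIndex (T / N j) t + 1)) atTop (𝓝 (u t)) := by
    refine tendsto_of_tendsto_of_dist hleft ?_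
    refine squeeze_zero' (Eventually.of_forall fun _ => dist_nonneg) ?_ hhs
    filter_upwards [hA, hS] with j hj hs
    rw [dist_comm, dist_eq_norm]
    exact hs.norm_step_le h hj (hj.stepIndex_lt ht)
  obtain ⟨j₀, hj₀⟩ := hA.exists
  have htτ : t ∈ Icc 0 b.τ := ⟨ht.1.le, ht.2.trans hj₀.T_le⟩
  have hY : Tendsto (fun j => constantInterpolant (T / N j) (Y j) t) atTop
      (𝓝 (D'.solution t (u t))) := by
    refine (h.regular.converges_const atTop).tendsto_solutions (Eventually.of_forall fun _ => h) h
      (hA.mono fun j hj => hj.grid_mem (hj.stepIndex_lt ht)) ?_ htime hleft htτ (hmem t ht') ?_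
      (h.solution_mem htτ (hmem t ht'))
    · filter_upwards [hA, hS] with j hj hs using hs.state_mem h hj (hj.stepIndex_lt ht).le
    · filter_upwards [hA, hS] with j hj hs using hs.argmin_step _ (hj.stepIndex_lt ht)
  exact ⟨hY, (h.regular.continuous_F.tendsto _).comp
    (htime.prodMk_nhds (hright.prodMk_nhds hY))⟩

/-- For a fixed problem, limits of interpolated states as the step size tends to `0` are
trajectories. -/
theorem Controlled.isTrajectory_of_tendsto_scheme [CompleteSpace E] (h : D'.Controlled b)
    (hN : Tendsto N atTop atTop) (hA : ∀ᶠ j in atTop, Admissible b T (N j))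
    (hS : ∀ᶠ j in atTop, D'.SchemeSolution b.x₀ T (N j) (X j) (Y j))
    (hu : ContinuousOn u (Icc 0 T))
    (hmem : ∀ t ∈ Icc 0 T, u t ∈ Metric.closedBall b.x₀ b.r)
    (hlim : ∀ t ∈ Icc 0 T,
      Tendsto (fun j => linearInterpolant (T / N j) (X j) t) atTop (𝓝 (u t))) :
    D'.IsTrajectory b T u := by
  refine ⟨hu, hmem, fun t ht => tendsto_nhds_unique (hlim t ht) ?_⟩
  have hsub : ∀ s ∈ uIoc 0 t, s ∈ Ioc 0 T := fun s hs => by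
    rw [uIoc_of_le ht.1] at hs
    exact ⟨hs.1, hs.2.trans ht.2⟩
  have hint := intervalIntegral.tendsto_integral_filter_of_dominated_convergence
    (l := atTop) (a := 0) (b := t) (μ := volume)
    (F := fun j => constantInterpolant (T / N j) (fun i => D'.F (i * (T / N j), X j i, Y j i)))
    (f := fun s => D'.F (s, u s, D'.solution s (u s))) (fun _ => b.speed)
    (Eventually.of_forall fun j =>
      (stronglyMeasurable_constantInterpolant _ _).aestronglyMeasurable)
    (by filter_upwards [hA, hS] with j hj hs
        exact Eventually.of_forall fun s hs' => hs.norm_rhs_le h hj (hsub s hs'))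
    intervalIntegrable_const
    (Eventually.of_forall fun s hs => (h.tendsto_scheme hN hA hS hmem hlim (hsub s hs)).2)
  refine (hint.const_add b.x₀).congr' ?_
  filter_upwards [hA, hS] with j hj hs using (hs.linearInterpolant_eq hj ht).2.symm

end FixedProblem

section VaryingProblem

variable {D : ℕ → CoupledProgram E V ι} {u : ℕ → ℝ → E} {u' : ℝ → E}

/-- Limits of trajectories of converging problems are trajectories of the limit problem. -/
theorem Converges.isTrajectory [CompleteSpace E] (hD : Converges atTop D D')
    (hb : ∀ᶠ k in atTop, (D k).Controlled b) (hb' : D'.Controlled b) (hT : T ≤ b.τ)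
    (hu : ∀ᶠ k in atTop, (D k).IsTrajectory b T (u k)) (hu' : ContinuousOn u' (Icc 0 T))
    (hmem : ∀ t ∈ Icc 0 T, u' t ∈ Metric.closedBall b.x₀ b.r)
    (hlim : ∀ t ∈ Icc 0 T, Tendsto (fun k => u k t) atTop (𝓝 (u' t))) :
    D'.IsTrajectory b T u' := by
  refine ⟨hu', hmem, fun t ht => tendsto_nhds_unique (hlim t ht) ?_⟩
  have hsub : ∀ s ∈ uIoc 0 t, s ∈ Icc 0 T := fun s hs => by
    rw [uIoc_of_le ht.1] at hs
    exact ⟨hs.1.le, hs.2.trans ht.2⟩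
  have hint := intervalIntegral.tendsto_integral_filter_of_dominated_convergence
    (l := atTop) (a := 0) (b := t) (μ := volume)
    (F := fun k s => (D k).F (s, u k s, (D k).solution s (u k s)))
    (f := fun s => D'.F (s, u' s, D'.solution s (u' s))) (fun _ => b.speed)
    (by filter_upwards [hb, hu] with k hk hk'
        exact aestronglyMeasurable_uIoc_of_continuousOn
          (hk.continuousOn_rhs hT hk'.continuousOn hk'.mem) ht)
    (by filter_upwards [hb, hu] with k hk hk'
        refine Eventually.of_forall fun s hs => ?_
        have hs1 := hsub s hs
        have hs2 : s ∈ Icc 0 b.τ := ⟨hs1.1, hs1.2.trans hT⟩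
        exact hk.norm_F_le_speed hs2 (hk'.mem s hs1)
          (hk.solutions_subset hs2 (hk'.mem s hs1) (hk.solution_mem hs2 (hk'.mem s hs1))))
    intervalIntegrable_const
    (Eventually.of_forall fun s hs => hD.F.comp tendsto_id
      (tendsto_const_nhds.prodMk_nhds ((hlim s (hsub s hs)).prodMk_nhds
        (hD.tendsto_solution hb hb' hT (hu.mono fun k hk => hk.mem) hmem (hsub s hs)
          (hlim s (hsub s hs))))))
  refine (hint.const_add b.x₀).congr' ?_
  filter_upwards [hu] with k hk using (hk.integral_eq t ht).symm

end VaryingProblem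

end CoupledProgram

/-! ### Extraction of subsequences -/

theorem supDist_eq_enorm {E : Type*} [NormedAddCommGroup E] {T : ℝ} {u v : ℝ → E}
    {f g : C(Icc 0 T, E)} (hf : ∀ t : Icc 0 T, u t = f t) (hg : ∀ t : Icc 0 T, v t = g t) :
    supDist T u v = ‖f - g‖ₑ := by
  rw [ContinuousMap.enorm_eq_iSup_enorm, supDist, iSup_subtype']
  exact iSup_congr fun t => by rw [hf, hg]; rfl

theorem iteratedLimitZero_of_tendsto {a : ℕ → ℕ → ℝ≥0∞} {L : ℕ → ℝ≥0∞} (hfin : ∀ k, L k ≠ ∞)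
    (ha : ∀ k, Tendsto (a k) atTop (𝓝 (L k))) (hL : Tendsto L atTop (𝓝 0)) :
    IteratedLimitZero a := by
  refine ⟨fun k => (L k).toNNReal, fun k => ?_, ?_⟩
  · rw [ENNReal.coe_toNNReal (hfin k)]
    exact ha k
  · exact (ENNReal.tendsto_toNNReal ENNReal.zero_ne_top).comp hL

namespace CoupledProgram

variable {E V ι : Type*} [NormedAddCommGroup E] [NormedSpace ℝ E]
  [NormedAddCommGroup V] [NormedSpace ℝ V]
  {D : CoupledProgram E V ι} {b : ControlConstants E V} {T : ℝ}

theorem SchemeSolution.exists_statePath [CompleteSpace E] {N : ℕ} {X : ℕ → E} {Y : ℕ → V}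
    (hS : D.SchemeSolution b.x₀ T N X Y) (h : D.Controlled b) (hA : Admissible b T N) :
    ∃ f ∈ statePaths b T, ∀ t : Icc 0 T, linearInterpolant (T / N) X t = f t := by
  have hlip : LipschitzWith b.speed.toNNReal fun t : Icc 0 T => linearInterpolant (T / N) X t :=
    LipschitzWith.of_dist_le_mul fun t s => by
      rw [dist_eq_norm, Real.coe_toNNReal _ h.speed_nonneg]
      exact hS.norm_linearInterpolant_sub_le h hA s.2 t.2
  refine ⟨⟨_, hlip.continuous⟩, ⟨hlip, fun t => mem_closedBall_iff_norm.2 ?_⟩, fun _ => rfl⟩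
  have h1 := hS.norm_linearInterpolant_sub_le h hA (s := 0) ⟨le_rfl, hA.T_pos.le⟩ t.2
  rw [linearInterpolant_zero, hS.init, sub_zero, abs_of_nonneg t.2.1] at h1
  refine h1.trans (le_trans ?_ hA.speed_le)
  rw [mul_comm]
  exact mul_le_mul_of_nonneg_right t.2.2 h.speed_nonneg

/-- Every horizon in the controlled region admits all large numbers of steps. -/
theorem eventually_admissible {E V : Type*} {b : ControlConstants E V} {T : ℝ} (hT : 0 < T)
    (hTτ : T ≤ b.τ) (hTr : T * b.speed ≤ b.r) : ∀ᶠ N : ℕ in atTop, Admissible b T N := by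
  have h1 : Tendsto (fun N : ℕ => T / (N : ℝ) * b.L) atTop (𝓝 0) := by
    simpa using (tendsto_const_nhds.div_atTop tendsto_natCast_atTop_atTop).mul_const b.L
  filter_upwards [eventually_gt_atTop 0,
    h1.eventually (ge_mem_nhds (by norm_num : (0 : ℝ) < 1 / 2))] with N h2 h3
  exact ⟨hT, hTτ, hTr, h2, h3⟩

/-- For all large sample sizes and then all large numbers of steps, the scheme is controlled. Along a
single sequence of step numbers, its states converge for all sample sizes at once, since a countable
product of compact metrizable sets is sequentially compact; a second extraction makes the limits
converge along a sequence of sample sizes. -/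
theorem Converges.exists_iterated_limits [ProperSpace E] [ProperSpace V] [Finite ι]
    {D : ℕ → CoupledProgram E V ι} {D' : CoupledProgram E V ι} (hD : Converges atTop D D')
    (hb : ∀ᶠ ν in atTop, (D ν).Controlled b) (hb' : D'.Controlled b) (hT : 0 < T)
    (hTτ : T ≤ b.τ) (hTr : T * b.speed ≤ b.r) {X : ℕ → ℕ → ℕ → E} {Y : ℕ → ℕ → ℕ → V}
    (hS : ∀ᶠ ν in atTop, ∀ᶠ N in atTop, (D ν).SchemeSolution b.x₀ T N (X ν N) (Y ν N)) :
    ∃ (νs Ns : ℕ → ℕ) (u : ℝ → E), StrictMono νs ∧ StrictMono Ns ∧ (∀ j, 0 < Ns j) ∧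
      D'.IsTrajectory b T u ∧
      IteratedLimitZero (fun k j =>
        supDist T (linearInterpolant (T / Ns j) (X (νs k) (Ns j))) u) ∧
      IteratedLimitZero (fun k j =>
        l2Dist T (constantInterpolant (T / Ns j) (Y (νs k) (Ns j)))
          fun t => D'.solution t (u t)) := by
  classical
  have hA := eventually_admissible hT hTτ hTr
  -- the interpolated states of good pairs `(ν, N)`, extended by a constant path to all pairs
  have hpath : ∀ ν N, ∃ f ∈ statePaths b T, ((D ν).Controlled b → Admissible b T N →
      (D ν).SchemeSolution b.x₀ T N (X ν N) (Y ν N) →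
      ∀ t : Icc 0 T, linearInterpolant (T / N) (X ν N) t = f t) := by
    intro ν N
    by_cases h : (D ν).Controlled b ∧ Admissible b T N ∧
        (D ν).SchemeSolution b.x₀ T N (X ν N) (Y ν N)
    · obtain ⟨f, hf, hf'⟩ := h.2.2.exists_statePath h.1 h.2.1
      exact ⟨f, hf, fun _ _ _ => hf'⟩
    · exact ⟨.const _ b.x₀, ⟨LipschitzWith.const _ |>.weaken zero_le,
        fun _ => Metric.mem_closedBall_self b.r_pos.le⟩, fun h1 h2 h3 => absurd ⟨h1, h2, h3⟩ h⟩
  choose U hUmem hU using hpath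
  have hK := isCompact_statePaths b T
  obtain ⟨f, hf, φ, hφ, hφlim⟩ := (isCompact_univ_pi fun _ : ℕ => hK).tendsto_subseq
    (x := fun N ν => U ν N) fun N ν _ => hUmem ν N
  rw [tendsto_pi_nhds] at hφlim
  obtain ⟨f', hf', ψ, hψ, hψlim⟩ := hK.tendsto_subseq (x := f) fun ν => hf ν trivial
  obtain ⟨ν₀, hν₀⟩ := eventually_atTop.1 (hb.and hS)
  -- shift the extracted sequences past the exceptional indices
  let νs : ℕ → ℕ := fun k => ψ (k + ν₀)
  let Ns : ℕ → ℕ := fun j => φ (j + 1)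
  have hνs : StrictMono νs := hψ.comp (strictMono_id.add_const ν₀)
  have hNs : StrictMono Ns := hφ.comp (strictMono_id.add_const 1)
  have hNs' : Tendsto Ns atTop atTop := hNs.tendsto_atTop
  have hbν : ∀ k, (D (νs k)).Controlled b := fun k =>
    (hν₀ _ ((Nat.le_add_left _ _).trans (hψ.le_apply))).1
  have hSν : ∀ k, ∀ᶠ j in atTop, (D (νs k)).SchemeSolution b.x₀ T (Ns j) (X (νs k) (Ns j))
      (Y (νs k) (Ns j)) := fun k =>
    hNs'.eventually (hν₀ _ ((Nat.le_add_left _ _).trans (hψ.le_apply))).2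
  have hAj : ∀ᶠ j in atTop, Admissible b T (Ns j) := hNs'.eventually hA
  have hUlim : ∀ k, Tendsto (fun j => U (νs k) (Ns j)) atTop (𝓝 (f (νs k))) := fun k =>
    (hφlim (νs k)).comp (tendsto_add_atTop_nat 1)
  have hflim : Tendsto (fun k => f (νs k)) atTop (𝓝 f') := hψlim.comp (tendsto_add_atTop_nat ν₀)
  have hUeq : ∀ k, ∀ᶠ j in atTop, ∀ t : Icc 0 T,
      linearInterpolant (T / Ns j) (X (νs k) (Ns j)) t = U (νs k) (Ns j) t := fun k => by
    filter_upwards [hAj, hSν k] with j h1 h2 using hU _ _ (hbν k) h1 h2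
  let u : ℕ → ℝ → E := fun k => IccExtend hT.le (f (νs k))
  let u' : ℝ → E := IccExtend hT.le f'
  have hext : ∀ (g : C(Icc 0 T, E)) (t : ℝ) (ht : t ∈ Icc 0 T), IccExtend hT.le g t = g ⟨t, ht⟩ :=
    fun g t ht => IccExtend_of_mem _ _ ht
  have hucont : ∀ g : C(Icc 0 T, E), ContinuousOn (IccExtend hT.le g) (Icc 0 T) := fun g =>
    g.continuous.Icc_extend'.continuousOn
  have humem : ∀ k, ∀ t ∈ Icc 0 T, u k t ∈ Metric.closedBall b.x₀ b.r := fun k t ht => by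
    simp only [u, hext _ t ht]
    exact (hf _ trivial).2 _
  have humem' : ∀ t ∈ Icc 0 T, u' t ∈ Metric.closedBall b.x₀ b.r := fun t ht => by
    simp only [u', hext _ t ht]
    exact hf'.2 _
  have hXlim : ∀ k, ∀ t ∈ Icc 0 T, Tendsto
      (fun j => linearInterpolant (T / Ns j) (X (νs k) (Ns j)) t) atTop (𝓝 (u k t)) := by
    intro k t ht
    simp only [u, hext _ t ht]
    refine ((ContinuousEvalConst.continuous_eval_const (F := C(Icc 0 T, E)) _).tendsto _
      |>.comp (hUlim k)).congr' ?_
    filter_upwards [hUeq k] with j hj using (hj ⟨t, ht⟩).symm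
  have hulim : ∀ t ∈ Icc 0 T, Tendsto (fun k => u k t) atTop (𝓝 (u' t)) := by
    intro t ht
    simp only [u, u', hext _ t ht]
    exact (ContinuousEvalConst.continuous_eval_const (F := C(Icc 0 T, E)) _).tendsto _
      |>.comp hflim
  have htraj : ∀ k, (D (νs k)).IsTrajectory b T (u k) := fun k =>
    (hbν k).isTrajectory_of_tendsto_scheme hNs' hAj (hSν k) (hucont _) (humem k) (hXlim k)
  have hDν := hD.comp hνs.tendsto_atTop
  have hbν' := Eventually.of_forall (f := atTop) hbν
  have htraj' : D'.IsTrajectory b T u' := hDν.isTrajectory hbν' hb' hTτ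
    (Eventually.of_forall htraj) (hucont _) humem' hulim
  -- the decisions and their limits stay in a fixed ball around the Slater point
  have hYbound : ∀ k, ∀ t ∈ Icc 0 T, ‖(D (νs k)).solution t (u k t) - b.y₀‖ ≤ b.radius :=
    fun k t ht => by
      have htτ : t ∈ Icc 0 b.τ := ⟨ht.1, ht.2.trans hTτ⟩
      exact (hbν k).solutions_subset htτ (humem k t ht) ((hbν k).solution_mem htτ (humem k t ht))
  have hYbound' : ∀ t ∈ Icc 0 T, ‖D'.solution t (u' t) - b.y₀‖ ≤ b.radius := fun t ht => by
    have htτ : t ∈ Icc 0 b.τ := ⟨ht.1, ht.2.trans hTτ⟩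
    exact hb'.solutions_subset htτ (humem' t ht) (hb'.solution_mem htτ (humem' t ht))
  have hYmeas : ∀ k, AEStronglyMeasurable (fun t => (D (νs k)).solution t (u k t))
      (volume.restrict (Icc (0 : ℝ) T)) := fun k =>
    ((hbν k).continuousOn_solution hTτ (hucont _) (humem k)).aestronglyMeasurable measurableSet_Icc
  have hYmeas' : AEStronglyMeasurable (fun t => D'.solution t (u' t))
      (volume.restrict (Icc (0 : ℝ) T)) :=
    (hb'.continuousOn_solution hTτ (hucont _) humem').aestronglyMeasurable measurableSet_Icc
  have hdiff : ∀ {v w : V}, ‖v - b.y₀‖ ≤ b.radius → ‖w - b.y₀‖ ≤ b.radius →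
      ‖v - w‖ ≤ b.radius + b.radius := fun {v w} hv hw => by
    rw [← sub_sub_sub_cancel_right v w b.y₀]
    exact (norm_sub_le _ _).trans (add_le_add hv hw)
  have hIcc : ∀ᵐ t ∂(volume.restrict (Icc (0 : ℝ) T)), t ∈ Icc 0 T :=
    ae_restrict_mem measurableSet_Icc
  have hIoc : ∀ᵐ t ∂(volume.restrict (Icc (0 : ℝ) T)), t ∈ Ioc 0 T := by
    rw [← restrict_Ioc_eq_restrict_Icc]
    exact ae_restrict_mem measurableSet_Ioc
  refine ⟨νs, Ns, u', hνs, hNs, fun j => (Nat.succ_pos j).trans_le hφ.le_apply, htraj', ?_, ?_⟩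
  · refine iteratedLimitZero_of_tendsto (L := fun k => ‖f (νs k) - f'‖ₑ)
      (fun k => enorm_ne_top) (fun k => ?_) ?_
    · refine ((hUlim k).sub_const f').enorm.congr' ?_
      filter_upwards [hUeq k] with j hj
      exact (supDist_eq_enorm hj fun t => hext f' t t.2).symm
    · have := (hflim.sub_const f').enorm
      rw [sub_self] at this
      exact enorm_zero (E := C(Icc 0 T, E)) ▸ this
  · refine iteratedLimitZero_of_tendsto
      (L := fun k => l2Dist T (fun t => (D (νs k)).solution t (u k t))
        fun t => D'.solution t (u' t)) (fun k => ?_) (fun k => ?_) ?_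
    · refine (MemLp.of_bound ((hYmeas k).sub hYmeas') (b.radius + b.radius) ?_).eLpNorm_ne_top
      filter_upwards [hIcc] with t ht using hdiff (hYbound k t ht) (hYbound' t ht)
    · refine tendsto_eLpNorm_two_of_bounded (b.radius + b.radius) ?_ ?_ ?_
      · exact Eventually.of_forall fun j =>
          (stronglyMeasurable_constantInterpolant _ _).aestronglyMeasurable.sub hYmeas'
      · filter_upwards [hAj, hSν k] with j h1 h2
        filter_upwards [hIoc] with t ht
        exact hdiff (h2.norm_decision_sub_le (hbν k) h1 (h1.stepIndex_lt ht))
          (hYbound' t (Ioc_subset_Icc_self ht))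
      · filter_upwards [hIoc] with t ht
        exact ((hbν k).tendsto_scheme hNs' hAj (hSν k) (humem k) (hXlim k) ht).1.sub_const _
    · have := tendsto_eLpNorm_two_of_bounded (μ := volume.restrict (Icc (0 : ℝ) T))
        (w := fun k t => (D (νs k)).solution t (u k t) - D'.solution t (u' t))
        (w' := fun _ => (0 : V)) (b.radius + b.radius)
        (Eventually.of_forall fun k => (hYmeas k).sub hYmeas')
        (Eventually.of_forall fun k => by
          filter_upwards [hIcc] with t ht using hdiff (hYbound k t ht) (hYbound' t ht))
        (by
          filter_upwards [hIcc] with t ht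
          have := hDν.tendsto_solution hbν' hb' hTτ (Eventually.of_forall humem) humem' ht
            (hulim t ht)
          simpa using this.sub_const (D'.solution t (u' t)))
      simpa [l2Dist] using this

end CoupledProgram

/-! ### Uniform control of converging problems -/

theorem ContinuouslyConverges.continuous {I Z W : Type*} [TopologicalSpace Z] [TopologicalSpace W]
    [RegularSpace W] {l : Filter I} [l.NeBot] {φ : I → Z → W} {ψ : Z → W}
    (h : ContinuouslyConverges l φ ψ) : Continuous ψ := by
  rw [continuous_iff_continuousAt]
  intro z
  rw [ContinuousAt, (closed_nhds_basis (ψ z)).tendsto_right_iff]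
  rintro O ⟨hO, hOc⟩
  have h1 := eventually_swap_iff.1 ((h z).eventually hO)
  filter_upwards [h1.curry] with w hw
  exact hOc.mem_of_tendsto (h.comp tendsto_id tendsto_const_nhds) hw

/-- A strict bound for the limit of a continuously convergent family on a compact set holds
eventually along the family. -/
theorem ContinuouslyConverges.eventually_forall_mem {I Z W : Type*} [TopologicalSpace Z]
    [TopologicalSpace W] {l : Filter I} {φ : I → Z → W} {ψ : Z → W}
    (h : ContinuouslyConverges l φ ψ) {K : Set Z} (hK : IsCompact K) {O : Set W} (hO : IsOpen O)
    (hψ : ∀ z ∈ K, ψ z ∈ O) : ∀ᶠ i in l, ∀ z ∈ K, φ i z ∈ O := by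
  have h1 : ∀ᶠ p : I × Z in l ×ˢ 𝓝ˢ K, φ p.1 p.2 ∈ O :=
    hK.mem_prod_nhdsSet_of_forall fun z hz => (h z).eventually (hO.mem_nhds (hψ z hz))
  exact h1.curry.mono fun i hi => hi.self_of_nhdsSet

namespace CoupledProgram

variable {E V ι : Type*} [NormedAddCommGroup E] [NormedAddCommGroup V] [NormedSpace ℝ V]

theorem Regular.mono {D : CoupledProgram E V ι} {L ϱ L' ϱ' : ℝ} (h : D.Regular L ϱ) (hL : L ≤ L')
    (hϱ : ϱ' ≤ ϱ) : D.Regular L' ϱ' where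
  lipschitz z z' := (h.lipschitz z z').trans (by gcongr)
  continuous_G := h.continuous_G
  strongConvex t x y₁ y₂ τ hτ := (h.strongConvex t x y₁ y₂ τ hτ).trans (by
    have h1 := hτ.1.le
    have h2 := sub_nonneg.2 hτ.2.le
    gcongr)
  continuous_c := h.continuous_c
  convex_c := h.convex_c

theorem Converges.regular {D : ℕ → CoupledProgram E V ι} {D' : CoupledProgram E V ι}
    (hD : Converges atTop D D') {L ϱ : ℝ} (hreg : ∀ᶠ ν in atTop, (D ν).Regular L ϱ) :
    D'.Regular L ϱ := by
  have hF := fun z => hD.F.comp tendsto_id (tendsto_const_nhds (x := z))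
  have hG := fun z => hD.G.comp tendsto_id (tendsto_const_nhds (x := z))
  have hc := fun i z => (hD.c i).comp tendsto_id (tendsto_const_nhds (x := z))
  refine ⟨fun z z' => ?_, hD.G.continuous, fun t x y₁ y₂ τ hτ => ?_,
    fun i => (hD.c i).continuous, fun i t x y₁ y₂ τ hτ => ?_⟩
  · refine le_of_tendsto ((hF z).sub (hF z')).norm ?_
    filter_upwards [hreg] with ν h using h.lipschitz z z'
  · refine le_of_tendsto_of_tendsto (hG _)
      ((((hG _).const_mul _).add ((hG _).const_mul _)).sub_const _) ?_
    filter_upwards [hreg] with ν h using h.strongConvex t x y₁ y₂ τ hτ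
  · refine le_of_tendsto_of_tendsto (hc i _) (((hc i _).const_mul _).add ((hc i _).const_mul _)) ?_
    filter_upwards [hreg] with ν h using h.convex_c i t x y₁ y₂ τ hτ

/-- A regular problem with a Slater point at time `0` and state `x₀` admits constants that control
it and, eventually, all regular problems converging to it. They are chosen from the limit problem
alone, with a margin. -/
theorem Regular.exists_controlConstants [ProperSpace E] [ProperSpace V] [Finite ι]
    {D' : CoupledProgram E V ι} {L ϱ : ℝ} (h : D'.Regular L ϱ) (hL : 0 ≤ L) (hϱ : 0 < ϱ) (x₀ : E)
    {y₀ : V} (hy₀ : ∀ i, D'.c i (0, x₀, y₀) < 0) :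
    ∃ b : ControlConstants E V, b.x₀ = x₀ ∧ D'.Controlled b ∧
      ∀ D : ℕ → CoupledProgram E V ι, Converges atTop D D' →
        (∀ᶠ ν in atTop, (D ν).Regular L ϱ) → ∀ᶠ ν in atTop, (D ν).Controlled b := by
  have hopen : IsOpen {w : ℝ × E | ∀ i, D'.c i (w.1, w.2, y₀) < 0} := by
    rw [ofPred_forall]
    refine isOpen_iInter_of_finite fun i => isOpen_lt ?_ continuous_const
    exact (h.continuous_c i).comp (by fun_prop)
  obtain ⟨ε, hε, hball⟩ := Metric.nhds_basis_closedBall.mem_iff.1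
    (hopen.mem_nhds (show ((0 : ℝ), x₀) ∈ _ from hy₀))
  have hslater : ∀ t ∈ Icc 0 ε, ∀ x ∈ Metric.closedBall x₀ ε, ∀ i, D'.c i (t, x, y₀) < 0 := by
    intro t ht x hx
    refine @hball (t, x) ?_
    rw [← closedBall_prod_same]
    refine ⟨?_, hx⟩
    rw [mem_closedBall_iff_norm, sub_zero, Real.norm_of_nonneg ht.1]
    exact ht.2
  let K : Set (ℝ × E × V) := Icc 0 ε ×ˢ Metric.closedBall x₀ ε ×ˢ Metric.closedBall y₀ 1
  have hK : IsCompact K :=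
    isCompact_Icc.prod ((isCompact_closedBall _ _).prod (isCompact_closedBall _ _))
  let K' : Set (ℝ × E × V) := Icc 0 ε ×ˢ Metric.closedBall x₀ ε ×ˢ {y₀}
  have hK' : IsCompact K' :=
    isCompact_Icc.prod ((isCompact_closedBall _ _).prod isCompact_singleton)
  obtain ⟨C, hC⟩ := hK.exists_bound_of_continuousOn h.continuous_G.continuousOn
  let b : ControlConstants E V :=
    { x₀ := x₀, y₀ := y₀, τ := ε, r := ε, L := L, ϱ := ϱ, C := C + 1
      M := ‖D'.F (0, x₀, y₀)‖ + 1
      τ_pos := hε, r_pos := hε, L_nonneg := hL, ϱ_pos := hϱ }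
  refine ⟨b, rfl, ⟨h, hslater, fun t ht x hx y hy => ?_, ?_⟩, fun D hD hreg => ?_⟩
  · exact (hC (t, x, y) ⟨ht, hx, hy⟩).trans (by simp [b])
  · simp [b]
  · have h1 : ∀ᶠ ν in atTop, ∀ i, ∀ z ∈ K', (D ν).c i z ∈ Iio (0 : ℝ) := by
      rw [eventually_all]
      refine fun i => (hD.c i).eventually_forall_mem hK' isOpen_Iio ?_
      rintro ⟨t, x, y⟩ ⟨ht, hx, hy⟩
      rw [mem_singleton_iff] at hy
      subst hy
      exact hslater t ht x hx i
    have h2 : ∀ᶠ ν in atTop, ∀ z ∈ K, (D ν).G z ∈ Metric.ball (0 : ℝ) (C + 1) := by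
      refine hD.G.eventually_forall_mem hK Metric.isOpen_ball fun z hz => ?_
      rw [mem_ball_zero_iff]
      exact (hC z hz).trans_lt (lt_add_one C)
    have h3 : ∀ᶠ ν in atTop, ‖(D ν).F (0, x₀, y₀)‖ < ‖D'.F (0, x₀, y₀)‖ + 1 :=
      (hD.F.comp tendsto_id tendsto_const_nhds).norm.eventually (gt_mem_nhds (lt_add_one _))
    filter_upwards [hreg, h1, h2, h3] with ν g0 g1 g2 g3
    exact ⟨g0, fun t ht x hx i => g1 i (t, x, y₀) ⟨ht, hx, rfl⟩,
      fun t ht x hx y hy => (mem_ball_zero_iff.1 (g2 (t, x, y) ⟨ht, hx, hy⟩)).le, g3.le⟩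

end CoupledProgram

/-! ### Sample average problems converge almost surely -/

namespace CoupledSystem

variable {n m q : ℕ} {S : Type*}

/-- The `i`-th constraint function of a single realization. Times are truncated at `0` here and in
`meanProgram` and `sampleProgram`, so that all data are continuous on the whole line. -/
def constraint (p : CoupledSystem n m q S) (i : Fin q)
    (z : ℝ × EuclideanSpace ℝ (Fin n) × EuclideanSpace ℝ (Fin m)) (s : S) : ℝ :=
  (p.A s *ᵥ z.2.1.ofLp) i + (p.B s *ᵥ z.2.2.ofLp) i + p.Q (max z.1 0) s i

/-- The sample average problem, with times truncated at `0`. -/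
noncomputable def sampleProgram (p : CoupledSystem n m q S) (s : ℕ → S) (ν : ℕ) :
    CoupledProgram (EuclideanSpace ℝ (Fin n)) (EuclideanSpace ℝ (Fin m)) (Fin q) where
  F z := p.sampleF s ν (max z.1 0) z.2.1 z.2.2
  G z := p.sampleG s ν (max z.1 0) z.2.1 z.2.2
  c i z := (1 / (ν : ℝ)) * ∑ l ∈ Finset.range ν, p.constraint i z (s l)

theorem sampleProgram_solutions (p : CoupledSystem n m q S) (s : ℕ → S) (ν : ℕ) {t : ℝ}
    (ht : 0 ≤ t) (x : EuclideanSpace ℝ (Fin n)) :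
    (p.sampleProgram s ν).solutions t x = p.sampleSolutionSet s ν t x := by
  simp only [CoupledProgram.solutions, sampleProgram, constraint, max_eq_left ht]
  rfl

theorem isSchemeSolution_iff (p : CoupledSystem n m q S) (s : ℕ → S) (ν : ℕ) {T : ℝ} (hT : 0 ≤ T)
    {N : ℕ} {X : ℕ → EuclideanSpace ℝ (Fin n)} {Y : ℕ → EuclideanSpace ℝ (Fin m)} :
    p.IsSchemeSolution s T ν N X Y ↔ (p.sampleProgram s ν).SchemeSolution p.x₀ T N X Y := by
  have ht : ∀ i : ℕ, (0 : ℝ) ≤ (i + 1 : ℕ) * (T / N) := fun i => by positivity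
  have hF : ∀ (i : ℕ) x y, (p.sampleProgram s ν).F ((i + 1 : ℕ) * (T / N), x, y) =
      p.sampleF s ν ((i + 1 : ℕ) * (T / N)) x y := fun i x y => by
    simp only [sampleProgram, max_eq_left (ht i)]
  constructor
  · rintro ⟨h1, h2, h3⟩
    refine ⟨h1, fun i hi => ?_, fun i hi => ?_⟩
    · rw [hF]; exact h2 i hi
    · rw [sampleProgram_solutions _ _ _ (ht i)]; exact h3 i hi
  · rintro ⟨h1, h2, h3⟩
    refine ⟨h1, fun i hi => ?_, fun i hi => ?_⟩
    · rw [← hF]; exact h2 i hi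
    · rw [← sampleProgram_solutions _ _ _ (ht i)]; exact h3 i hi

/-- The pathwise regularity of the data at a single realization `s`, with Lipschitz constant `κ` and
strong convexity modulus `ϱ`. -/
structure RegularAt (p : CoupledSystem n m q S) (s : S) (κ ϱ : ℝ) : Prop where
  lipschitz_f : ∀ z z' : ℝ × EuclideanSpace ℝ (Fin n) × EuclideanSpace ℝ (Fin m),
    ‖p.f (max z.1 0) z.2.1 z.2.2 s - p.f (max z'.1 0) z'.2.1 z'.2.2 s‖ ≤
      κ * (|z.1 - z'.1| + ‖z.2.1 - z'.2.1‖ + ‖z.2.2 - z'.2.2‖)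
  continuous_g : Continuous
    fun z : ℝ × EuclideanSpace ℝ (Fin n) × EuclideanSpace ℝ (Fin m) =>
      p.g (max z.1 0) z.2.1 z.2.2 s
  strongConvex_g : ∀ t x y₁ y₂, ∀ τ ∈ Ioo (0 : ℝ) 1,
    p.g (max t 0) x ((1 - τ) • y₁ + τ • y₂) s ≤
      (1 - τ) * p.g (max t 0) x y₁ s + τ * p.g (max t 0) x y₂ s -
        1 / 2 * ϱ * τ * (1 - τ) * ‖y₁ - y₂‖ ^ 2
  continuous_Q : Continuous fun t => p.Q (max t 0) s

theorem RegularAt.continuous_f {p : CoupledSystem n m q S} {s : S} {κ ϱ : ℝ}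
    (h : p.RegularAt s κ ϱ) : Continuous
      fun z : ℝ × EuclideanSpace ℝ (Fin n) × EuclideanSpace ℝ (Fin m) =>
        p.f (max z.1 0) z.2.1 z.2.2 s := by
  rw [continuous_iff_continuousAt]
  intro z
  rw [ContinuousAt, tendsto_iff_norm_sub_tendsto_zero]
  refine squeeze_zero (fun _ => norm_nonneg _) (fun w => h.lipschitz_f w z) ?_
  have : Continuous fun w : ℝ × EuclideanSpace ℝ (Fin n) × EuclideanSpace ℝ (Fin m) =>
      κ * (|w.1 - z.1| + ‖w.2.1 - z.2.1‖ + ‖w.2.2 - z.2.2‖) := by fun_prop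
  simpa using this.tendsto z

theorem RegularAt.continuous_constraint {p : CoupledSystem n m q S} {s : S} {κ ϱ : ℝ}
    (h : p.RegularAt s κ ϱ) (i : Fin q) : Continuous fun z => p.constraint i z s := by
  have h1 := h.continuous_Q
  unfold constraint
  refine Continuous.add (Continuous.add ?_ ?_) ?_
  · simp only [Matrix.mulVec, dotProduct]
    fun_prop
  · simp only [Matrix.mulVec, dotProduct]
    fun_prop
  · exact (EuclideanSpace.proj (𝕜 := ℝ) i).continuous.comp (h1.comp continuous_fst)

theorem constraint_segment (p : CoupledSystem n m q S) (i : Fin q) (t : ℝ)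
    (x : EuclideanSpace ℝ (Fin n)) (y₁ y₂ : EuclideanSpace ℝ (Fin m)) (τ : ℝ) (s : S) :
    p.constraint i (t, x, (1 - τ) • y₁ + τ • y₂) s =
      (1 - τ) * p.constraint i (t, x, y₁) s + τ * p.constraint i (t, x, y₂) s := by
  simp only [constraint, WithLp.ofLp_add, WithLp.ofLp_smul, Matrix.mulVec_add, Matrix.mulVec_smul,
    Pi.add_apply, Pi.smul_apply, smul_eq_mul]
  ring

/-- Averages of regular realizations are regular, with averaged constants. -/
theorem regular_sampleProgram {p : CoupledSystem n m q S} {s : ℕ → S} {κ ϱ : S → ℝ}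
    (h : ∀ l, p.RegularAt (s l) (κ (s l)) (ϱ (s l))) (ν : ℕ) :
    (p.sampleProgram s ν).Regular ((1 / (ν : ℝ)) • ∑ l ∈ Finset.range ν, κ (s l))
      ((1 / (ν : ℝ)) • ∑ l ∈ Finset.range ν, ϱ (s l)) where
  lipschitz z z' := by
    simp only [sampleProgram, sampleF]
    rw [← smul_sub, ← Finset.sum_sub_distrib, norm_smul, Real.norm_of_nonneg (by positivity),
      smul_eq_mul, mul_assoc, Finset.sum_mul]
    gcongr
    exact norm_sum_le_of_le _ fun l _ => (h l).lipschitz_f z z'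
  continuous_G :=
    continuous_const.mul (continuous_finsetSum _ fun l _ => (h l).continuous_g)
  strongConvex t x y₁ y₂ τ hτ := by
    simp only [sampleProgram, sampleG]
    have h1 := Finset.sum_le_sum fun l (_ : l ∈ Finset.range ν) =>
      (h l).strongConvex_g t x y₁ y₂ τ hτ
    have h2 := mul_le_mul_of_nonneg_left h1 (by positivity : (0 : ℝ) ≤ 1 / ν)
    rw [Finset.sum_sub_distrib, Finset.sum_add_distrib, ← Finset.mul_sum, ← Finset.mul_sum,
      ← Finset.sum_mul, ← Finset.sum_mul, ← Finset.sum_mul, ← Finset.mul_sum] at h2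
    refine h2.trans_eq ?_
    rw [smul_eq_mul]
    ring
  continuous_c i :=
    continuous_const.mul (continuous_finsetSum _ fun l _ => (h l).continuous_constraint i)
  convex_c i t x y₁ y₂ τ _ := by
    simp only [sampleProgram, constraint_segment, Finset.sum_add_distrib, ← Finset.mul_sum]
    apply le_of_eq
    ring

variable {Ω : Type*} [MeasurableSpace Ω] {P : Measure Ω} {ξ : Ω → S}

/-- The problem with exact expectations, with times truncated at `0`. -/
noncomputable def meanProgram (p : CoupledSystem n m q S) (P : Measure Ω) (ξ : Ω → S) :
    CoupledProgram (EuclideanSpace ℝ (Fin n)) (EuclideanSpace ℝ (Fin m)) (Fin q) where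
  F z := p.meanF P ξ (max z.1 0) z.2.1 z.2.2
  G z := p.meanG P ξ (max z.1 0) z.2.1 z.2.2
  c i z := (p.meanA P ξ *ᵥ z.2.1.ofLp) i + (p.meanB P ξ *ᵥ z.2.2.ofLp) i +
    p.meanQ P ξ (max z.1 0) i

theorem meanProgram_solutions (p : CoupledSystem n m q S) {t : ℝ} (ht : 0 ≤ t)
    (x : EuclideanSpace ℝ (Fin n)) :
    (p.meanProgram P ξ).solutions t x = p.solutionSet P ξ t x := by
  simp only [CoupledProgram.solutions, meanProgram, max_eq_left ht]
  rfl

/-- An interior point of the feasible set at time `0` satisfies all constraints strictly: an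
affine function that is nonpositive near one of its zeros has zero slope, and then the constraint
would read `0 ≤ 0`. -/
theorem slater_of_mem_interior {p : CoupledSystem n m q S} (hrow : p.NoVacuousActiveRow P ξ)
    {y₀ : EuclideanSpace ℝ (Fin m)} (hy₀ : y₀ ∈ interior (p.feasible P ξ 0 p.x₀)) (i : Fin q) :
    (p.meanProgram P ξ).c i (0, p.x₀, y₀) < 0 := by
  have hmem := interior_subset hy₀
  simp only [meanProgram, max_self]
  refine lt_of_le_of_ne (hmem i) fun h0 => ?_
  have hB : ∀ j, p.meanB P ξ i j = 0 := by
    intro j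
    let e : EuclideanSpace ℝ (Fin m) := EuclideanSpace.single j 1
    have hcont : Continuous fun c : ℝ => y₀ + c • e := by fun_prop
    have hev : ∀ᶠ c : ℝ in 𝓝 0, y₀ + c • e ∈ p.feasible P ξ 0 p.x₀ := by
      have : Tendsto (fun c : ℝ => y₀ + c • e) (𝓝 0) (𝓝 y₀) := by
        simpa using hcont.tendsto 0
      exact this.eventually (mem_interior_iff_mem_nhds.1 hy₀)
    have hval : ∀ c : ℝ, (p.meanB P ξ *ᵥ (y₀ + c • e).ofLp) i =
        (p.meanB P ξ *ᵥ y₀.ofLp) i + c * p.meanB P ξ i j := fun c => by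
      simp [e, Matrix.mulVec_add, Matrix.mulVec_smul]
    have hev2 : ∀ᶠ c : ℝ in 𝓝 0, c * p.meanB P ξ i j ≤ 0 := by
      filter_upwards [hev] with c hc
      have := hc i
      rw [hval] at this
      linarith
    obtain ⟨ε, hε, hb⟩ := Metric.eventually_nhds_iff.1 hev2
    have h1 := @hb (ε / 2) (by rw [Real.dist_eq, sub_zero, abs_of_pos (half_pos hε)]; linarith)
    have h2 := @hb (-(ε / 2)) (by
      rw [Real.dist_eq, sub_zero, abs_neg, abs_of_pos (half_pos hε)]; linarith)
    nlinarith
  refine hrow i ⟨hB, ?_⟩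
  have : (p.meanB P ξ *ᵥ y₀.ofLp) i = 0 := by
    simp [Matrix.mulVec, dotProduct, hB]
  linarith

theorem isWeakSolution_of_isTrajectory {p : CoupledSystem n m q S}
    {b : ControlConstants (EuclideanSpace ℝ (Fin n)) (EuclideanSpace ℝ (Fin m))}
    (hx₀ : b.x₀ = p.x₀) (h : (p.meanProgram P ξ).Controlled b) {T : ℝ} (hT : 0 < T)
    (hTτ : T ≤ b.τ) {u : ℝ → EuclideanSpace ℝ (Fin n)}
    (hu : (p.meanProgram P ξ).IsTrajectory b T u) :
    p.IsWeakSolution P ξ T u fun t => (p.meanProgram P ξ).solution t (u t) := by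
  have hrhs := h.continuousOn_rhs hTτ hu.continuousOn hu.mem
  have hsol : ∀ t ∈ Icc 0 T,
      (p.meanProgram P ξ).solution t (u t) ∈ (p.meanProgram P ξ).solutions t (u t) :=
    fun t ht => h.solution_mem ⟨ht.1, ht.2.trans hTτ⟩ (hu.mem t ht)
  refine ⟨?_, ?_, fun t ht => ?_, fun t ht => ?_⟩
  · have hlip : LipschitzOnWith b.speed.toNNReal u (uIcc 0 T) := by
      rw [uIcc_of_le hT.le]
      refine LipschitzOnWith.of_dist_le_mul fun t ht s hs => ?_
      have hint : ∀ w ∈ Icc 0 T, IntervalIntegrable (fun s => (p.meanProgram P ξ).F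
          (s, u s, (p.meanProgram P ξ).solution s (u s))) volume 0 w := fun w hw =>
        (hrhs.mono (Icc_subset_Icc_right hw.2)).intervalIntegrable_of_Icc hw.1
      rw [dist_eq_norm, hu.integral_eq t ht, hu.integral_eq s hs, add_sub_add_left_eq_sub,
        intervalIntegral.integral_interval_sub_left (hint t ht) (hint s hs),
        Real.coe_toNNReal _ h.speed_nonneg]
      refine intervalIntegral.norm_integral_le_of_norm_le_const fun w hw => ?_
      rw [uIoc, mem_Ioc] at hw
      have hw' : w ∈ Icc 0 T :=
        ⟨((le_min hs.1 ht.1).trans_lt hw.1).le, hw.2.trans (max_le hs.2 ht.2)⟩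
      have hw'' : w ∈ Icc 0 b.τ := ⟨hw'.1, hw'.2.trans hTτ⟩
      exact h.norm_F_le_speed hw'' (hu.mem w hw')
        (h.solutions_subset hw'' (hu.mem w hw') (hsol w hw'))
    exact hlip.absolutelyContinuousOnInterval
  · exact (h.continuousOn_solution hTτ hu.continuousOn hu.mem).integrableOn_Icc
  · rw [← meanProgram_solutions p ht.1]
    exact hsol t ht
  · rw [← hx₀, hu.integral_eq t ht]
    congr 1
    refine intervalIntegral.integral_congr fun s hs => ?_
    rw [uIcc_of_le ht.1] at hs
    simp only [meanProgram, max_eq_left hs.1]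

variable [MeasurableSpace S]

theorem meanProgram_c_eq {p : CoupledSystem n m q S} (hp : p.StandingAssumptions P ξ)
    (hξ : AEMeasurable ξ P) (i : Fin q)
    (z : ℝ × EuclideanSpace ℝ (Fin n) × EuclideanSpace ℝ (Fin m)) :
    ∫ ω, p.constraint i z (ξ ω) ∂P = (p.meanProgram P ξ).c i z := by
  have hA : ∀ j, Integrable (fun ω => p.A (ξ ω) i j * z.2.1.ofLp j) P := fun j =>
    ((hp.integrable_A i j).comp_aemeasurable hξ).mul_const _
  have hB : ∀ j, Integrable (fun ω => p.B (ξ ω) i j * z.2.2.ofLp j) P := fun j =>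
    ((hp.integrable_B i j).comp_aemeasurable hξ).mul_const _
  have hQ : Integrable (fun ω => p.Q (max z.1 0) (ξ ω)) P :=
    (hp.integrable_Q _ (le_max_right _ _)).comp_aemeasurable hξ
  have hQi : Integrable (fun ω => p.Q (max z.1 0) (ξ ω) i) P :=
    (EuclideanSpace.proj (𝕜 := ℝ) i).integrable_comp hQ
  have hQint : ∫ ω, p.Q (max z.1 0) (ξ ω) i ∂P = p.meanQ P ξ (max z.1 0) i :=
    (EuclideanSpace.proj (𝕜 := ℝ) i).integral_comp_comm hQ
  have hAs := integrable_finsetSum Finset.univ fun j _ => hA j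
  have hBs := integrable_finsetSum Finset.univ fun j _ => hB j
  calc ∫ ω, p.constraint i z (ξ ω) ∂P
      = ∫ ω, (∑ j, p.A (ξ ω) i j * z.2.1.ofLp j + ∑ j, p.B (ξ ω) i j * z.2.2.ofLp j) +
          p.Q (max z.1 0) (ξ ω) i ∂P := rfl
    _ = (∫ ω, (∑ j, p.A (ξ ω) i j * z.2.1.ofLp j + ∑ j, p.B (ξ ω) i j * z.2.2.ofLp j) ∂P) +
          ∫ ω, p.Q (max z.1 0) (ξ ω) i ∂P := integral_add (hAs.add hBs) hQi
    _ = (∑ j, (∫ ω, p.A (ξ ω) i j ∂P) * z.2.1.ofLp j +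
          ∑ j, (∫ ω, p.B (ξ ω) i j ∂P) * z.2.2.ofLp j) + p.meanQ P ξ (max z.1 0) i := by
        rw [integral_add hAs hBs, integral_finsetSum _ fun j _ => hA j,
          integral_finsetSum _ fun j _ => hB j, hQint]
        simp only [integral_mul_const]
    _ = (p.meanProgram P ξ).c i z := rfl

/-- Strong convexity is assumed with an exceptional null set that may depend on time and state. By
continuity of the objective it suffices to have it on a countable dense set of times and states, so
one null set serves all of them. -/
theorem ae_regularAt {p : CoupledSystem n m q S} (hp : p.StandingAssumptions P ξ)
    {κ ϱ : S → ℝ}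
    (hκ : ∀ᵐ s ∂(P.map ξ), ∀ t₁ t₂ : ℝ, 0 ≤ t₁ → 0 ≤ t₂ → ∀ u₁ u₂ v₁ v₂,
      ‖p.f t₁ u₁ v₁ s - p.f t₂ u₂ v₂ s‖ ≤ κ s * (|t₁ - t₂| + ‖u₁ - u₂‖ + ‖v₁ - v₂‖))
    (hκ0 : ∀ s, 0 ≤ κ s)
    (hϱ : ∀ t, 0 ≤ t → ∀ x, ∀ᵐ s ∂(P.map ξ), ∀ y₁ y₂, ∀ τ ∈ Ioo (0 : ℝ) 1,
      p.g t x ((1 - τ) • y₁ + τ • y₂) s ≤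
        (1 - τ) * p.g t x y₁ s + τ * p.g t x y₂ s -
          1 / 2 * ϱ s * τ * (1 - τ) * ‖y₁ - y₂‖ ^ 2) :
    ∀ᵐ s ∂(P.map ξ), p.RegularAt s (κ s) (ϱ s) := by
  obtain ⟨D, hDc, hD⟩ := TopologicalSpace.exists_countable_dense (ℝ × EuclideanSpace ℝ (Fin n))
  have hϱD : ∀ᵐ s ∂(P.map ξ), ∀ w ∈ D, ∀ y₁ y₂, ∀ τ ∈ Ioo (0 : ℝ) 1,
      p.g (max w.1 0) w.2 ((1 - τ) • y₁ + τ • y₂) s ≤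
        (1 - τ) * p.g (max w.1 0) w.2 y₁ s + τ * p.g (max w.1 0) w.2 y₂ s -
          1 / 2 * ϱ s * τ * (1 - τ) * ‖y₁ - y₂‖ ^ 2 :=
    (ae_ball_iff hDc).2 fun w _ => hϱ _ (le_max_right _ _) w.2
  filter_upwards [hκ, hϱD, hp.continuous_g, hp.continuous_Q] with s h1 h2 h3 h4
  have hg : Continuous fun z : ℝ × EuclideanSpace ℝ (Fin n) × EuclideanSpace ℝ (Fin m) =>
      p.g (max z.1 0) z.2.1 z.2.2 s :=
    h3.comp_continuous (f := fun z : ℝ × EuclideanSpace ℝ (Fin n) × EuclideanSpace ℝ (Fin m) =>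
      (max z.1 0, z.2.1, z.2.2)) (by fun_prop) fun z =>
      ⟨mem_Ici.2 (le_max_right _ _), trivial⟩
  refine ⟨fun z z' => ?_, hg, fun t x y₁ y₂ τ hτ => ?_, ?_⟩
  · refine (h1 _ _ (le_max_right _ _) (le_max_right _ _) _ _ _ _).trans ?_
    have := abs_max_sub_max_le_abs z.1 z'.1 0
    have := hκ0 s
    gcongr
  · -- both sides are continuous in `(t, x)`, and the inequality holds on a dense set
    have hgc : ∀ y, Continuous fun w : ℝ × EuclideanSpace ℝ (Fin n) =>
        p.g (max w.1 0) w.2 y s := fun y =>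
      hg.comp (f := fun w : ℝ × EuclideanSpace ℝ (Fin n) => (w.1, w.2, y)) (by fun_prop)
    have hclosed : IsClosed {w : ℝ × EuclideanSpace ℝ (Fin n) |
        p.g (max w.1 0) w.2 ((1 - τ) • y₁ + τ • y₂) s ≤
          (1 - τ) * p.g (max w.1 0) w.2 y₁ s + τ * p.g (max w.1 0) w.2 y₂ s -
            1 / 2 * ϱ s * τ * (1 - τ) * ‖y₁ - y₂‖ ^ 2} :=
      isClosed_le (hgc _) (((continuous_const.mul (hgc _)).add
        (continuous_const.mul (hgc _))).sub continuous_const)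
    exact hclosed.closure_subset_iff.2 (fun w hw => h2 w hw y₁ y₂ τ hτ) (hD (t, x))
  · exact h4.comp_continuous (f := fun t : ℝ => max t 0) (by fun_prop) fun t =>
      mem_Ici.2 (le_max_right _ _)

theorem abs_mulVec_le {k : ℕ} (M : Matrix (Fin q) (Fin k) ℝ) (x : EuclideanSpace ℝ (Fin k))
    (i : Fin q) : |(M *ᵥ x.ofLp) i| ≤ (∑ j, |M i j|) * ‖x‖ := by
  rw [Matrix.mulVec, dotProduct, Finset.sum_mul]
  refine (Finset.abs_sum_le_sum_abs _ _).trans (Finset.sum_le_sum fun j _ => ?_)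
  rw [abs_mul]
  exact mul_le_mul_of_nonneg_left (PiLp.norm_apply_le x j) (abs_nonneg _)

/-- Along almost every sample, the sample average problems converge continuously to the problem
with exact expectations. -/
theorem ae_converges_sampleProgram [IsProbabilityMeasure P] {p : CoupledSystem n m q S}
    (hp : p.StandingAssumptions P ξ) (hξ : AEMeasurable ξ P) {κ ϱ : S → ℝ}
    (hκ : Integrable κ (P.map ξ)) (hreg : ∀ᵐ s ∂(P.map ξ), p.RegularAt s (κ s) (ϱ s))
    {sample : ℕ → Ω → S} (hindep : iIndepFun sample P)
    (hident : ∀ l, IdentDistrib (sample l) ξ P P) :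
    ∀ᵐ ω ∂P, CoupledProgram.Converges atTop (fun ν => p.sampleProgram (fun l => sample l ω) ν)
      (p.meanProgram P ξ) := by
  have hcomp : ∀ {R : ℝ} {z : ℝ × EuclideanSpace ℝ (Fin n) × EuclideanSpace ℝ (Fin m)},
      z ∈ Metric.closedBall 0 R → |z.1| ≤ R ∧ ‖z.2.1‖ ≤ R ∧ ‖z.2.2‖ ≤ R := fun {R z} hz => by
    rw [mem_closedBall_zero_iff] at hz
    have h1 : ‖z.2‖ ≤ R := (norm_snd_le z).trans hz
    exact ⟨(norm_fst_le z).trans hz, (norm_fst_le z.2).trans h1, (norm_snd_le z.2).trans h1⟩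
  have hmax : ∀ {t R : ℝ}, |t| ≤ R → max t 0 ≤ R := fun {t R} ht =>
    max_le ((le_abs_self t).trans ht) ((abs_nonneg t).trans ht)
  have hF := ae_continuouslyConverges_sample_average (P := P)
    (0 : ℝ × EuclideanSpace ℝ (Fin n) × EuclideanSpace ℝ (Fin m)) hξ hindep hident
    (h := fun z s => p.f (max z.1 0) z.2.1 z.2.2 s)
    (fun z => (hp.integrable_f _ (le_max_right _ _) _ _).1)
    (by filter_upwards [hreg] with s hs using hs.continuous_f)
    (fun R => by
      refine ⟨fun s => ‖p.f 0 0 0 s‖ + |κ s| * (R + R + R),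
        (hp.integrable_f 0 le_rfl 0 0).norm.add (hκ.abs.mul_const _), ?_⟩
      filter_upwards [hreg] with s hs z hz
      obtain ⟨h1, h2, h3⟩ := hcomp hz
      have h4 := hs.lipschitz_f z 0
      simp only [Prod.fst_zero, Prod.snd_zero, max_self, sub_zero] at h4
      have h5 : κ s * (|z.1| + ‖z.2.1‖ + ‖z.2.2‖) ≤ |κ s| * (R + R + R) := by
        have := le_abs_self (κ s)
        gcongr
      linarith [norm_le_norm_add_norm_sub' (p.f (max z.1 0) z.2.1 z.2.2 s) (p.f 0 0 0 s)])
  have hG := ae_continuouslyConverges_sample_average (P := P)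
    (0 : ℝ × EuclideanSpace ℝ (Fin n) × EuclideanSpace ℝ (Fin m)) hξ hindep hident
    (h := fun z s => p.g (max z.1 0) z.2.1 z.2.2 s)
    (fun z => (hp.integrable_g _ (le_max_right _ _) _ _).1)
    (by filter_upwards [hreg] with s hs using hs.continuous_g)
    (fun R => by
      obtain ⟨κg, hκg, hb⟩ := hp.dominated_g R
      refine ⟨κg, hκg, ?_⟩
      filter_upwards [hb] with s hs z hz
      obtain ⟨h1, h2, h3⟩ := hcomp hz
      exact hs _ _ _ (le_max_right _ _) (hmax h1) h2 h3)
  have hc : ∀ i, ∀ᵐ ω ∂P, _ := fun i => ae_continuouslyConverges_sample_average (P := P)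
    (0 : ℝ × EuclideanSpace ℝ (Fin n) × EuclideanSpace ℝ (Fin m)) hξ hindep hident
    (h := p.constraint i)
    (fun z => by
      have : Integrable (fun s => p.constraint i z s) (P.map ξ) :=
        ((integrable_finsetSum Finset.univ fun j _ =>
          (hp.integrable_A i j).mul_const (z.2.1.ofLp j)).add
        (integrable_finsetSum Finset.univ fun j _ =>
          (hp.integrable_B i j).mul_const (z.2.2.ofLp j))).add
        ((EuclideanSpace.proj (𝕜 := ℝ) i).integrable_comp
          (hp.integrable_Q (max z.1 0) (le_max_right _ _)))
      exact this.1)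
    (by filter_upwards [hreg] with s hs using hs.continuous_constraint i)
    (fun R => by
      obtain ⟨κQ, -, hκQ0, hκQ, hb⟩ := hp.bound_Q
      refine ⟨fun s => (∑ j, |p.A s i j|) * R + (∑ j, |p.B s i j|) * R + κQ s * R,
        (((integrable_finsetSum _ fun j _ => (hp.integrable_A i j).abs).mul_const _).add
        ((integrable_finsetSum _ fun j _ => (hp.integrable_B i j).abs).mul_const _)).add
        (hκQ.mul_const _), ?_⟩
      filter_upwards [hb] with s hs z hz
      obtain ⟨h1, h2, h3⟩ := hcomp hz
      rw [constraint, Real.norm_eq_abs]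
      refine (abs_add_le _ _).trans (add_le_add ((abs_add_le _ _).trans (add_le_add ?_ ?_)) ?_)
      · exact (abs_mulVec_le _ _ i).trans (by gcongr)
      · exact (abs_mulVec_le _ _ i).trans (by gcongr)
      · exact (PiLp.norm_apply_le (p.Q (max z.1 0) s) i).trans
          ((hs _ (le_max_right _ _)).trans
            (mul_le_mul_of_nonneg_left (hmax h1) (hκQ0 s))))
  filter_upwards [hF, hG, ae_all_iff.2 hc] with ω h1 h2 h3
  refine ⟨h1, h2, fun i => ?_⟩
  have h4 := h3 i
  simp only [meanProgram_c_eq hp hξ i] at h4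
  exact h4

end CoupledSystem

theorem mainTheorem5 {n m q d : ℕ} {Ω : Type*} [MeasurableSpace Ω]
    (P : Measure Ω) [IsProbabilityMeasure P]
    (Ξ : Set (EuclideanSpace ℝ (Fin d))) (ξ : Ω → Ξ) (hξ : Measurable ξ)
    (p : CoupledSystem n m q Ξ)
    (hstanding : p.StandingAssumptions P ξ)
    (hconvex : p.StronglyConvex P ξ)
    (hint : (interior (p.feasible P ξ 0 p.x₀)).Nonempty)
    (hrow : p.NoVacuousActiveRow P ξ)
    (sample : ℕ → Ω → Ξ) (hindep : iIndepFun sample P)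
    (hident : ∀ l, IdentDistrib (sample l) ξ P P) :
    ∃ T₀ : ℝ, 0 < T₀ ∧ ∀ T : ℝ, 0 < T → T ≤ T₀ → ∀ᵐ ω ∂P,
      (∀ᶠ ν : ℕ in atTop, ∀ᶠ N : ℕ in atTop,
        ∃ X Y, p.IsSchemeSolution (fun l => sample l ω) T ν N X Y) ∧
      ∀ (X : ℕ → ℕ → ℕ → EuclideanSpace ℝ (Fin n)) (Y : ℕ → ℕ → ℕ → EuclideanSpace ℝ (Fin m)),
        (∀ᶠ ν : ℕ in atTop, ∀ᶠ N : ℕ in atTop,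
          p.IsSchemeSolution (fun l => sample l ω) T ν N (X ν N) (Y ν N)) →
        ∃ (νs Ns : ℕ → ℕ) (x : ℝ → EuclideanSpace ℝ (Fin n)) (y : ℝ → EuclideanSpace ℝ (Fin m)),
          StrictMono νs ∧ StrictMono Ns ∧ (∀ j, 0 < Ns j) ∧
          p.IsWeakSolution P ξ T x y ∧
          IteratedLimitZero (fun k j =>
            supDist T (linearInterpolant (T / Ns j) (X (νs k) (Ns j))) x) ∧
          IteratedLimitZero (fun k j =>
            l2Dist T (constantInterpolant (T / Ns j) (Y (νs k) (Ns j))) y) := by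
  obtain ⟨κ, -, hκ0, hκ, hlip⟩ := hstanding.lipschitz_f
  obtain ⟨ϱ, -, hϱ0, hϱ, hconv⟩ := hconvex
  have hreg := CoupledSystem.ae_regularAt hstanding hlip hκ0 hconv
  obtain ⟨y₀, hy₀⟩ := hint
  have hξ' : AEMeasurable ξ P := hξ.aemeasurable
  have hκm : 0 ≤ ∫ ω, κ (ξ ω) ∂P := integral_nonneg fun ω => hκ0 _
  have hϱm : 0 < ∫ ω, ϱ (ξ ω) ∂P := by
    rw [integral_pos_iff_support_of_nonneg (fun ω => (hϱ0 (ξ ω)).le) (hϱ.comp_aemeasurable hξ')]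
    have : Function.support (fun ω => ϱ (ξ ω)) = univ :=
      eq_univ_of_forall fun ω => (hϱ0 (ξ ω)).ne'
    rw [this, measure_univ]
    exact one_pos
  -- constants with a margin, so that they serve the sample averages of large samples as well
  have hL : 0 ≤ (∫ ω, κ (ξ ω) ∂P) + 1 := by linarith
  have hgood : ∀ᵐ ω ∂P,
      CoupledProgram.Converges atTop (fun ν => p.sampleProgram (fun l => sample l ω) ν)
        (p.meanProgram P ξ) ∧
      ∀ᶠ ν in atTop, (p.sampleProgram (fun l => sample l ω) ν).Regular
        ((∫ ω, κ (ξ ω) ∂P) + 1) ((∫ ω, ϱ (ξ ω) ∂P) / 2) := by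
    filter_upwards [CoupledSystem.ae_converges_sampleProgram hstanding hξ' hκ hreg hindep hident,
      ae_forall_sample hident hreg, ae_tendsto_sample_average hξ' hindep hident hκ,
      ae_tendsto_sample_average hξ' hindep hident hϱ] with ω h1 h2 h3 h4
    refine ⟨h1, ?_⟩
    filter_upwards [h3.eventually (ge_mem_nhds (lt_add_one _)),
      h4.eventually (le_mem_nhds (half_lt_self hϱm))] with ν h5 h6
    exact (CoupledSystem.regular_sampleProgram h2 ν).mono h5 h6
  have hmean : (p.meanProgram P ξ).Regular ((∫ ω, κ (ξ ω) ∂P) + 1) ((∫ ω, ϱ (ξ ω) ∂P) / 2) := by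
    obtain ⟨ω, h1, h2⟩ := hgood.exists
    exact h1.regular h2
  obtain ⟨b, hbx, hb, hbD⟩ := hmean.exists_controlConstants hL (half_pos hϱm) p.x₀
    (CoupledSystem.slater_of_mem_interior hrow hy₀)
  have hspeed := hb.speed_nonneg
  refine ⟨min b.τ (b.r / (b.speed + 1)), lt_min b.τ_pos (div_pos b.r_pos (by linarith)),
    fun T hT hT₀ => ?_⟩
  have hTτ : T ≤ b.τ := hT₀.trans (min_le_left _ _)
  have hTr : T * b.speed ≤ b.r := by
    have h1 := (le_div_iff₀ (by linarith)).1 (hT₀.trans (min_le_right _ _))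
    linarith
  filter_upwards [hgood] with ω hω
  have hbν := hbD _ hω.1 hω.2
  refine ⟨?_, fun X Y hS => ?_⟩
  · filter_upwards [hbν] with ν hν
    filter_upwards [CoupledProgram.eventually_admissible hT hTτ hTr] with N hN
    obtain ⟨X, Y, h⟩ := hν.exists_schemeSolution hN
    rw [hbx] at h
    exact ⟨X, Y, (p.isSchemeSolution_iff _ ν hT.le).2 h⟩
  · simp only [p.isSchemeSolution_iff _ _ hT.le, ← hbx] at hS
    obtain ⟨νs, Ns, u, h1, h2, h3, h4, h5, h6⟩ :=
      hω.1.exists_iterated_limits hbν hb hT hTτ hTr hS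
    exact ⟨νs, Ns, u, _, h1, h2, h3,
      CoupledSystem.isWeakSolution_of_isTrajectory hbx hb hT hTτ h4, h5, h6⟩
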